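/- For an oriented link diagram $D$ let $s_0D$ be the collection of circles obtained by giving every crossing its $0$-smoothing (at a positive crossing this is the orientation-preserving, or Seifert, smoothing), and let $G_0(D)$ be the multigraph whose vertices are the circles of $s_0D$ and which has one edge for each crossing, joining the circles of the two arcs of the smoothing at that crossing; for a positive diagram (one without negative crossings) this is the Seifert graph. For a multigraph $G$ let $G^{red}$ be the graph obtained from $G$ by identifying parallel edges (edges with the same pair of ends). A diagram is reduced if it has no nugatory crossing, i.e. no crossing at which two opposite corners belong to the same face of the diagram. Let $Kh^i(D)$ denote the integral Khovanov homology group of $D$ in homological degree $i$, summed over all quantum degrees (the quantum grading is disregarded). Let $D$ be a reduced positive diagram of a link $L$, and let $D'$ be a positive diagram of a link $L'$ such that $G_0(D')\cong G_0(D)^{red}$ as graphs. Then $Kh^1(D)\cong Kh^1(D')$ as abelian groups; that is, $Kh^1(L)\cong Kh^1(L')$, where the Khovanov homology groups of $L$ and $L'$ are computed from the diagrams $D$ and $D'$. -/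

import Mathlib

/-! ### Multigraphs: parallel edges and isomorphisms -/

/-- The reduced graph of a multigraph: parallel edges (edges with the same ends) are identified, so
there is one edge, labelled by the unordered pair `{x, y}`, for each pair of adjacent vertices. -/
def Graph.reduced {α β : Type*} (G : Graph α β) : Graph α (Sym2 α) where
  vertexSet := G.vertexSet
  IsLink e x y := e = s(x, y) ∧ G.Adj x y
  isLink_symm := by
    refine fun e _ => ⟨?_⟩
    rintro x y ⟨rfl, h⟩
    exact ⟨Sym2.eq_swap, h.symm⟩
  eq_or_eq_of_isLink_of_isLink := by
    rintro e x y v w ⟨rfl, _⟩ ⟨h, _⟩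
    rw [Sym2.eq_iff] at h
    tauto
  left_mem_of_isLink := by
    rintro e x y ⟨_, h⟩
    exact h.left_mem

/-- Isomorphisms of multigraphs: bijections on vertices and on edges that respect incidence. -/
structure Graph.MultiIso {α β α' β' : Type*} (G : Graph α β) (H : Graph α' β') where
  vertexEquiv : G.vertexSet ≃ H.vertexSet
  edgeEquiv : G.edgeSet ≃ H.edgeSet
  isLink_iff : ∀ (e : G.edgeSet) (x y : G.vertexSet),
    G.IsLink e x y ↔ H.IsLink (edgeEquiv e) (vertexEquiv x) (vertexEquiv y)

/-! ### Oriented link diagrams -/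

/-- Counterclockwise rotation about a crossing. The four half-edges at the crossing `c` are
`(c, 0), (c, 1), (c, 2), (c, 3)`, in counterclockwise order. -/
def rotateHalfEdge (n : ℕ) : Equiv.Perm (Fin n × Fin 4) :=
  Equiv.prodCongr (Equiv.refl _) (Equiv.addRight 1)

/-- Whether the half-edge in position `i` of a crossing points away from the crossing. Position `0`
is the incoming end of the lower strand, so position `2` is its outgoing end; the upper strand runs
from position `3` to position `1` at a positive crossing and from `1` to `3` at a negative one. -/
def isOutgoing (positive : Bool) (i : Fin 4) : Prop :=
  i = 2 ∨ i = if positive then 1 else 3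

/-- The permutation of the half-edges whose cycles are the boundaries of the faces: follow the edge
to its other end, then take the next half-edge in clockwise order. The face of `h` is the one that
contains the corner between `h` and the counterclockwise next half-edge. -/
def facePermutation {n : ℕ} (glue : Equiv.Perm (Fin n × Fin 4)) : Equiv.Perm (Fin n × Fin 4) :=
  (rotateHalfEdge n)⁻¹ * glue

/-- The equivalence relation of lying in the same connected component of the underlying
four-valent graph. -/
def connectedSetoid {n : ℕ} (glue : Equiv.Perm (Fin n × Fin 4)) : Setoid (Fin n × Fin 4) :=
  Relation.EqvGen.setoid fun a b => b = glue a ∨ b = rotateHalfEdge n a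

/-- An oriented link diagram with ordered crossings, as an oriented plane four-valent graph with
crossing information, together with a number of circles without crossings. The four half-edges at a
crossing are numbered counterclockwise, beginning with the incoming end of the lower strand (a planar
diagram code). How the connected components of the diagram are placed in the faces of one
another is not recorded. -/
structure LinkDiagram where
  /-- the number of crossings -/
  n : ℕ
  /-- the number of components that are circles without crossings -/
  loops : ℕ
  /-- whether a crossing is positive -/
  positive : Fin n → Bool
  /-- sends each half-edge to the other half of the same edge -/
  glue : Equiv.Perm (Fin n × Fin 4)
  glue_glue : ∀ h, glue (glue h) = h
  /-- every edge leads from an outgoing half-edge to an incoming one -/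
  oriented : ∀ h, isOutgoing (positive (glue h).1) (glue h).2 ↔ ¬ isOutgoing (positive h.1) h.2
  /-- The diagram is planar: Euler's formula `V - E + F = 2 C`, with `V = n` crossings, `E = 2 n`
  edges, `F` faces and `C` connected components (each on a sphere of its own). -/
  planar : Nat.card (Quotient (Equiv.Perm.SameCycle.setoid (facePermutation glue))) =
    n + 2 * Nat.card (Quotient (connectedSetoid glue))

noncomputable section

namespace LinkDiagram

variable (D : LinkDiagram)

/-- A half-edge is given by a crossing and a position at that crossing. -/
abbrev HalfEdge : Type := Fin D.n × Fin 4

/-- A diagram is positive if it has no negative crossings. -/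
def IsPositive : Prop := ∀ c, D.positive c = true

/-- The number of negative crossings. -/
def numNegative : ℕ := (Finset.univ.filter fun c => D.positive c = false).card

/-- A crossing is nugatory if two opposite corners at it belong to the same face, that is, if some
circle in the plane meets the diagram only in this crossing, passing through it from one corner to
the opposite one. -/
def IsNugatory (c : Fin D.n) : Prop :=
  ∃ i : Fin 4, (facePermutation D.glue).SameCycle (c, i) (c, i + 2)

/-- A diagram is reduced if it has no nugatory crossings. -/
def IsReduced : Prop := ∀ c, ¬ D.IsNugatory c

/-! ### States, resolutions and state graphs -/

/-- A state assigns a marker to every crossing: `false` is the marker `0`, `true` the marker `1`. -/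
abbrev State : Type := Fin D.n → Bool

/-- The state with the marker `0` at every crossing. -/
def zeroState : D.State := fun _ => false

/-- The number of markers `1` of a state. -/
def weight (s : D.State) : ℕ := (Finset.univ.filter fun c => s c = true).card

/-- The smoothing of a crossing: the marker `0` joins position `0` to `1` and `2` to `3`,
the marker `1` joins position `0` to `3` and `1` to `2`. -/
def smooth (s : D.State) (h : D.HalfEdge) : D.HalfEdge :=
  (h.1, if s h.1 then ![3, 2, 1, 0] h.2 else ![1, 0, 3, 2] h.2)

/-- The equivalence relation of lying on the same circle of the resolution. -/
def circleSetoid (s : D.State) : Setoid D.HalfEdge :=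
  Relation.EqvGen.setoid fun a b => b = D.glue a ∨ b = D.smooth s a

/-- The circles of the resolution `sD`. -/
abbrev Circle (s : D.State) : Type := Quotient (D.circleSetoid s) ⊕ Fin D.loops

/-- The circle of the resolution `sD` through a half-edge. -/
def circleOf (s : D.State) (h : D.HalfEdge) : D.Circle s := Sum.inl (Quotient.mk _ h)

/-- The state graph: its vertices are the circles of `sD`, and every crossing `c` gives an edge, the
chord between the two arcs of the smoothing at `c` (under both smoothings, the positions `0` and
`2` lie on different arcs). -/
def stateGraph (s : D.State) : Graph (D.Circle s) (Fin D.n) where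
  vertexSet := Set.univ
  IsLink c x y := s(x, y) = s(D.circleOf s (c, 0), D.circleOf s (c, 2))
  isLink_symm := by
    refine fun c _ => ⟨fun x y h => ?_⟩
    rw [Sym2.eq_swap]
    exact h
  eq_or_eq_of_isLink_of_isLink := by
    intro c x y v w h h'
    have h2 := h.trans h'.symm
    rw [Sym2.eq_iff] at h2
    tauto
  left_mem_of_isLink := fun _ _ _ _ => Set.mem_univ _

/-! ### Khovanov homology -/

instance (s : D.State) : Fintype (D.Circle s) := Fintype.ofFinite _

instance (s : D.State) : DecidableEq (D.Circle s) := Classical.decEq _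

/-- The labellings of the circles of `sD` by `v₊` (`true`) and `v₋` (`false`). -/
abbrev Labelling (s : D.State) : Type := D.Circle s → Bool

/-- The group `V_s = V^{⊗ |sD|}`, where `V` is free on `v₊` and `v₋`: the free abelian group on the
labellings of the circles, a labelling being the tensor product of its labels. -/
abbrev VertexGroup (s : D.State) : Type := D.Labelling s → ℤ

/-- The coefficient of `z` in the product `m (x ⊗ y)`, where `m (v₊ ⊗ v₊) = v₊`,
`m (v₊ ⊗ v₋) = m (v₋ ⊗ v₊) = v₋` and `m (v₋ ⊗ v₋) = 0`. -/
def mulCoeff : Bool → Bool → Bool → ℤ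
  | true, true, true => 1
  | true, false, false => 1
  | false, true, false => 1
  | _, _, _ => 0

/-- The coefficient of `x ⊗ y` in the coproduct `Δ z`, where `Δ v₊ = v₊ ⊗ v₋ + v₋ ⊗ v₊` and
`Δ v₋ = v₋ ⊗ v₋`. -/
def comulCoeff : Bool → Bool → Bool → ℤ
  | true, true, false => 1
  | true, false, true => 1
  | false, false, false => 1
  | _, _, _ => 0

/-- Labellings of the circles of `sD` and `tD` agree on the crossingless components and on all the
circles of `sD` that do not pass by the crossing `k`. -/
def AgreeAway (s t : D.State) (k : Fin D.n) (x : D.Labelling s) (y : D.Labelling t) : Prop :=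
  (∀ i : Fin D.loops, x (Sum.inr i) = y (Sum.inr i)) ∧
  ∀ h : D.HalfEdge, D.circleOf s h ≠ D.circleOf s (k, 0) → D.circleOf s h ≠ D.circleOf s (k, 2) →
    x (D.circleOf s h) = y (D.circleOf t h)

open Classical in
/-- The coefficient of the labelling `y` in the image of the labelling `x` under the map of the edge
of the cube from `s` to `t`, where `t` arises from `s` by changing the marker at `k` from `0` to `1`.
If two different circles of `sD` pass by `k`, they merge into one circle of `tD`; otherwise
the circle of `sD` at `k` splits into two circles of `tD`. -/
def edgeCoeff (s t : D.State) (k : Fin D.n) (x : D.Labelling s) (y : D.Labelling t) : ℤ :=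
  if D.AgreeAway s t k x y then
    if D.circleOf s (k, 0) ≠ D.circleOf s (k, 2) then
      mulCoeff (x (D.circleOf s (k, 0))) (x (D.circleOf s (k, 2))) (y (D.circleOf t (k, 0)))
    else
      comulCoeff (x (D.circleOf s (k, 0))) (y (D.circleOf t (k, 0))) (y (D.circleOf t (k, 2)))
  else 0

/-- The map `V_s → V_t` of the edge of the cube from `s` to `t` that changes the marker at `k`. -/
def edgeMap (s t : D.State) (k : Fin D.n) : D.VertexGroup s →ₗ[ℤ] D.VertexGroup t :=
  Matrix.mulVecLin (Matrix.of fun y x => D.edgeCoeff s t k x y)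

/-- The states with exactly `r` markers `1`. -/
abbrev StateOfWeight (r : ℤ) : Type := {s : D.State // (D.weight s : ℤ) = r}

/-- The chain group in degree `r`: the direct sum of the groups `V_s` over the states `s` with `r`
markers `1`. -/
abbrev ChainGroup (r : ℤ) : Type := (s : D.StateOfWeight r) → D.VertexGroup s.1

open Classical in
/-- The differential from degree `r` to degree `q`, the sum over all edges of the cube, from `s` to
`t` by a change of the marker at `k`, of `(-1) ^ #{j < k | s j = 1}` times the edge map. It is zero
unless `q = r + 1`. -/
def differential (r q : ℤ) : D.ChainGroup r →ₗ[ℤ] D.ChainGroup q :=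
  LinearMap.pi fun t => ∑ s : D.StateOfWeight r, ∑ k : Fin D.n,
    if s.1 k = false ∧ t.1 = Function.update s.1 k true then
      ((-1 : ℤ) ^ (Finset.univ.filter fun j => j < k ∧ s.1 j = true).card) •
        (D.edgeMap s.1 t.1 k ∘ₗ LinearMap.proj s)
    else 0

/-- The homology group `H^r(D)` of the unshifted complex: cycles modulo boundaries. -/
abbrev UnshiftedHomology (r : ℤ) : Type :=
  LinearMap.ker (D.differential r (r + 1)) ⧸
    (LinearMap.range (D.differential (r - 1) r)).submoduleOf
      (LinearMap.ker (D.differential r (r + 1)))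

/-- The Khovanov homology group `Kh^i(D)` with integer coefficients, in homological degree `i`, that
is, the sum of the groups `Kh^{i,j}(D)` over all quantum degrees `j`. The complex is shifted
by the number of negative crossings. -/
abbrev Kh (i : ℤ) : Type := D.UnshiftedHomology (i + D.numNegative)

end LinkDiagram

end

/-! Write X for the set of Seifert circles and V₀ = V^{⊗X} for the group at the zero state. The
Seifert graph of a positive diagram has no loops (`IsPositive.circleOf_ne`), so every edge of the
cube leaving the zero state merges two circles. Its map m_c : V₀ → V_c is onto, and its kernel
depends only on the chord of c, the pair of circles that c joins. Hence every chain of degree 1 has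
the form x_c = m_c(z_c) with z_c in V₀.

The squares at the bottom of the cube commute, so x is a cycle exactly when, for all c ≠ d, the
composite V₀ → V_c → V_{cd} kills z_c - z_d. If c and d are not parallel, the second map is another
merge, and the composite multiplies the factors along both chords. If they are parallel, the second
map is a split; comultiplication is injective, so the kernel is that of the first merge alone. In
both cases it is the `mergeKernel` of the two chords (`IsPositive.edgeMap_comp_eq_zero_iff`). In
particular the values of a cycle at parallel crossings determine each other, and one z per pair of
adjacent circles suffices.

So Kh^1 is the group of compatible families, indexed by the adjacent pairs, modulo the families that
agree with a single element of V₀ up to the kernels of the merges (`IsPositive.exists_surjective`).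
This description uses only X and the set of adjacent pairs, that is, the reduced Seifert graph.

Two geometric facts carry the argument. Absence of loops comes from planarity: Euler's formula
yields an Alexander numbering of the faces, which separates the two circles at a crossing. That the
second of two parallel crossings splits comes from cutting the two oriented Seifert circles into
arcs at the crossings (`IsPositive.exists_separating`). -/

/-! ### Pushing labellings forward along a map -/

open Classical in
/-- The labelling `x` of `X` stands for the monomial in the variables `a` with `x a = false`. The
coefficient of the monomial `y` in the image of `x` under the substitution `a ↦ p a`, where squares
of variables vanish. -/
noncomputable def pushCoeff {X Y : Type*} (p : X → Y) (x : X → Bool) (y : Y → Bool) : ℤ :=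
  if Set.BijOn p {a | x a = false} {b | y b = false} then 1 else 0

/-- The linear map `V^{⊗ X} → V^{⊗ Y}` that multiplies the tensor
factors along the fibres of `p`. -/
noncomputable def pushMap {X Y : Type*} [Fintype X] [DecidableEq X] (p : X → Y) :
    ((X → Bool) → ℤ) →ₗ[ℤ] ((Y → Bool) → ℤ) :=
  Matrix.mulVecLin (Matrix.of fun y x => pushCoeff p x y)

section Push

variable {X Y Z : Type*}

theorem pushMap_apply [Fintype X] [DecidableEq X] (p : X → Y) (f : (X → Bool) → ℤ) (y : Y → Bool) :
    pushMap p f y = ∑ x, pushCoeff p x y * f x := rfl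

/-- Substitutions compose. If `p` is injective on the variables of `x`, the only monomial in the
image of `x` is the one supported on the image set; otherwise a square appears and both sides
vanish. -/
theorem sum_pushCoeff_mul [Fintype Y] [DecidableEq Y] (p : X → Y) (q : Y → Z) (x : X → Bool) (z : Z → Bool) :
    ∑ y, pushCoeff q y z * pushCoeff p x y = pushCoeff (q ∘ p) x z := by
  classical
  by_cases hp : Set.InjOn p {a | x a = false}
  · have key : ∀ y : Y → Bool, Set.BijOn p {a | x a = false} {b | y b = false} ↔
        y = fun b => decide (b ∉ p '' {a | x a = false}) := by
      intro y
      constructor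
      · intro h
        rw [h.image_eq]
        funext b
        cases hb : y b <;> simp [hb]
      · rintro rfl
        have : {b | (decide (b ∉ p '' {a | x a = false})) = false} = p '' {a | x a = false} := by
          ext b; simp
        rw [this]
        exact hp.bijOn_image
    rw [Finset.sum_eq_single (fun b => decide (b ∉ p '' {a | x a = false}))]
    · have e1 : pushCoeff p x (fun b => decide (b ∉ p '' {a | x a = false})) = 1 := by
        rw [pushCoeff, if_pos ((key _).2 rfl)]
      have : {b | (decide (b ∉ p '' {a | x a = false})) = false} = p '' {a | x a = false} := by
        ext b; simp
      rw [e1, mul_one, pushCoeff, pushCoeff, this]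
      congr 1
      rw [eq_iff_iff]
      constructor
      · intro h
        exact h.comp hp.bijOn_image
      · intro h
        refine ⟨?_, ?_, ?_⟩
        · rintro _ ⟨a, ha, rfl⟩
          exact h.mapsTo ha
        · rintro _ ⟨a, ha, rfl⟩ _ ⟨b, hb, rfl⟩ hab
          rw [h.injOn ha hb hab]
        · intro b hb
          obtain ⟨a, ha, rfl⟩ := h.surjOn hb
          exact ⟨p a, ⟨a, ha, rfl⟩, rfl⟩
    · intro y _ hy
      have : pushCoeff p x y = 0 := by
        rw [pushCoeff, if_neg]
        exact fun h => hy ((key y).1 h)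
      rw [this, mul_zero]
    · simp
  · rw [Finset.sum_eq_zero]
    · rw [pushCoeff, if_neg]
      intro h
      exact hp fun a ha b hb hab => h.injOn ha hb (congrArg q hab)
    · intro y _
      have : pushCoeff p x y = 0 := by
        rw [pushCoeff, if_neg]
        exact fun h => hp h.injOn
      rw [this, mul_zero]

theorem pushMap_pushMap [Fintype X] [DecidableEq X] [Fintype Y] [DecidableEq Y]
    (p : X → Y) (q : Y → Z) (f : (X → Bool) → ℤ) :
    pushMap q (pushMap p f) = pushMap (q ∘ p) f := by
  funext z
  simp only [pushMap_apply, ← sum_pushCoeff_mul p q, Finset.sum_mul, Finset.mul_sum]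
  rw [Finset.sum_comm]
  simp only [mul_assoc]

theorem pushMap_id [Fintype X] [DecidableEq X] (f : (X → Bool) → ℤ) : pushMap (id : X → X) f = f := by
  classical
  funext y
  rw [pushMap_apply, Finset.sum_eq_single y]
  · rw [pushCoeff, if_pos (Set.bijOn_id _), one_mul]
  · intro x _ hx
    rw [pushCoeff, if_neg, zero_mul]
    intro h
    apply hx
    have := h.image_eq
    rw [Set.image_id] at this
    funext a
    have ha := Set.ext_iff.1 this a
    simp only [Set.mem_ofPred_eq] at ha
    cases h1 : x a <;> cases h2 : y a <;> simp_all
  · simp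

theorem pushMap_surjective [Fintype X] [DecidableEq X] [Fintype Y] [DecidableEq Y]
    {p : X → Y} (hp : Function.Surjective p) :
    Function.Surjective (pushMap p) := by
  intro f
  refine ⟨pushMap (Function.surjInv hp) f, ?_⟩
  rw [pushMap_pushMap]
  have : p ∘ Function.surjInv hp = id := funext (Function.surjInv_eq hp)
  rw [this, pushMap_id]

/-- Under the hypotheses `q` factors through `p`, so `pushMap q` factors through `pushMap p`. Thus
the kernel for a surjection depends only on its fibres, which is how kernels for different
resolutions are compared. -/
theorem ker_pushMap_le [Fintype X] [DecidableEq X] [Fintype Y] [DecidableEq Y]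
    {p : X → Y} {q : X → Z} (hp : Function.Surjective p)
    (h : ∀ a b, p a = p b → q a = q b) :
    LinearMap.ker (pushMap p) ≤ LinearMap.ker (pushMap q) := by
  intro f hf
  rw [LinearMap.mem_ker] at hf ⊢
  have : q = (q ∘ Function.surjInv hp) ∘ p := by
    funext a
    exact h _ _ (Function.surjInv_eq hp (p a)).symm
  rw [this, ← pushMap_pushMap, hf, map_zero]

/-- Merging two elements `u` and `v` is the multiplication of the Frobenius algebra. -/
theorem pushCoeff_merge {p : X → Y} (hp : Function.Surjective p) {u v : X} (huv : u ≠ v)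
    (hk : ∀ a b, p a = p b ↔ a = b ∨ (a = u ∨ a = v) ∧ (b = u ∨ b = v))
    (x : X → Bool) (y : Y → Bool) [Decidable (∀ a, a ≠ u → a ≠ v → x a = y (p a))] :
    pushCoeff p x y = if ∀ a, a ≠ u → a ≠ v → x a = y (p a) then
      LinkDiagram.mulCoeff (x u) (x v) (y (p u)) else 0 := by
  classical
  have hpuv : p v = p u := (hk v u).2 (by simp)
  have hsep : ∀ a b, a ≠ u → a ≠ v → p b = p a → b = a := by
    intro a b h1 h2 h
    rcases (hk b a).1 h with h | ⟨_, h | h⟩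
    · exact h
    · exact absurd h h1
    · exact absurd h h2
  have hiff : Set.BijOn p {a | x a = false} {b | y b = false} ↔
      (∀ a, a ≠ u → a ≠ v → x a = y (p a)) ∧
        LinkDiagram.mulCoeff (x u) (x v) (y (p u)) = 1 := by
    constructor
    · intro h
      have hm : ∀ a, x a = false → y (p a) = false := fun a ha => h.mapsTo ha
      have hs : ∀ b, y b = false → ∃ a, x a = false ∧ p a = b := fun b hb => h.surjOn hb
      -- This is the relation m (v₋ ⊗ v₋) = 0: both variables would go to the same one. The
      -- remaining entries of the multiplication table are checked by `decide`.
      have hi : ¬ (x u = false ∧ x v = false) := fun ⟨h1, h2⟩ => huv (h.injOn h1 h2 hpuv.symm)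
      constructor
      · intro a h1 h2
        cases hya : y (p a)
        · obtain ⟨b, hb, hba⟩ := hs _ hya
          rw [← hsep a b h1 h2 hba, hb]
        · cases hxa : x a
          · rw [hm a hxa] at hya; exact hya
          · rfl
      · have h1 := hm u
        have h2 := hm v
        rw [hpuv] at h2
        have h3 : y (p u) = false → x u = false ∨ x v = false := by
          intro hy
          obtain ⟨b, hb, hbu⟩ := hs _ hy
          rcases (hk b u).1 hbu with h | ⟨h | h, _⟩
          · left; rw [← h, hb]
          · left; rw [← h, hb]
          · right; rw [← h, hb]
        revert h1 h2 h3 hi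
        generalize x u = α
        generalize x v = β
        generalize y (p u) = γ
        revert α β γ
        decide
    · rintro ⟨hag, hmul⟩
      have hfacts : (x u = false → y (p u) = false) ∧ (x v = false → y (p u) = false) ∧
          ¬ (x u = false ∧ x v = false) ∧ (y (p u) = false → x u = false ∨ x v = false) := by
        revert hmul
        generalize x u = α
        generalize x v = β
        generalize y (p u) = γ
        revert α β γ
        decide
      obtain ⟨h1, h2, h3, h4⟩ := hfacts
      refine ⟨?_, ?_, ?_⟩
      · intro a ha
        simp only [Set.mem_ofPred_eq] at ha ⊢
        by_cases hu : a = u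
        · subst hu; exact h1 ha
        by_cases hv : a = v
        · subst hv; rw [hpuv]; exact h2 ha
        rw [← hag a hu hv, ha]
      · intro a ha b hb hab
        simp only [Set.mem_ofPred_eq] at ha hb
        rcases (hk a b).1 hab with h | ⟨rfl | rfl, rfl | rfl⟩
        · exact h
        · rfl
        · exact absurd ⟨ha, hb⟩ h3
        · exact absurd ⟨hb, ha⟩ h3
        · rfl
      · intro b hb
        simp only [Set.mem_ofPred_eq] at hb
        obtain ⟨a, rfl⟩ := hp b
        by_cases hu : a = u ∨ a = v
        · have : p a = p u := (hk a u).2 (Or.inr ⟨hu, Or.inl rfl⟩)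
          rw [this] at hb ⊢
          rcases h4 hb with h | h
          · exact ⟨u, h, rfl⟩
          · exact ⟨v, h, hpuv⟩
        · push Not at hu
          exact ⟨a, by rw [Set.mem_ofPred_eq, hag a hu.1 hu.2, hb], rfl⟩
  have h01 : LinkDiagram.mulCoeff (x u) (x v) (y (p u)) = 1 ∨
      LinkDiagram.mulCoeff (x u) (x v) (y (p u)) = 0 := by
    generalize x u = α
    generalize x v = β
    generalize y (p u) = γ
    revert α β γ
    decide
  rw [pushCoeff]
  simp only [hiff]
  split_ifs with h h' h'
  · exact h.2.symm
  · exact absurd h.1 h'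
  · rcases h01 with h1 | h1
    · exact absurd ⟨h', h1⟩ h
    · exact h1.symm
  · rfl

end Push

/-! ### Euler's formula and the Alexander numbering -/

open Module

/-- The functions that are constant on the classes of a setoid. -/
def invariantFunctions {H : Type*} (S : Setoid H) : Submodule ℚ (H → ℚ) where
  carrier := {f | ∀ a b, S a b → f a = f b}
  add_mem' := fun hf hg a b h => by simp [hf a b h, hg a b h]
  zero_mem' := fun _ _ _ => rfl
  smul_mem' := fun c f hf a b h => by simp [hf a b h]

/-- Turns the numbers of faces, edges, crossings and components in Euler's formula into dimensions.
-/
theorem finrank_invariantFunctions {H : Type*} [Finite H] (S : Setoid H) :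
    finrank ℚ (invariantFunctions S) = Nat.card (Quotient S) := by
  classical
  have := Fintype.ofFinite (Quotient S)
  let e : invariantFunctions S ≃ₗ[ℚ] (Quotient S → ℚ) :=
    { toFun := fun f q => Quotient.lift f.1 (fun a b h => f.2 a b h) q
      invFun := fun u => ⟨fun h => u (Quotient.mk S h), fun a b h =>
        congrArg u (Quotient.sound h)⟩
      map_add' := fun f g => by
        funext q
        induction q using Quotient.ind
        rfl
      map_smul' := fun c f => by
        funext q
        induction q using Quotient.ind
        rfl
      left_inv := fun f => rfl
      right_inv := fun u => by
        funext q
        induction q using Quotient.ind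
        rfl }
  rw [e.finrank_eq, finrank_fintype_fun_eq_card, Nat.card_eq_fintype_card]

namespace LinkDiagram

variable {D : LinkDiagram}

/-- The orientation as a function on the half-edges: `1` on the outgoing ones, `-1` on the
incoming ones of a positive diagram. -/
def orientationSign (D : LinkDiagram) (h : D.HalfEdge) : ℚ := ![-1, 1, 1, -1] h.2

theorem IsPositive.isOutgoing_iff (hD : D.IsPositive) (h : D.HalfEdge) :
    isOutgoing (D.positive h.1) h.2 ↔ h.2 = 1 ∨ h.2 = 2 := by
  rw [hD h.1, isOutgoing, or_comm]
  rfl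

theorem IsPositive.glue_outgoing (hD : D.IsPositive) (h : D.HalfEdge) :
    ((D.glue h).2 = 1 ∨ (D.glue h).2 = 2) ↔ ¬ (h.2 = 1 ∨ h.2 = 2) := by
  rw [← hD.isOutgoing_iff, ← hD.isOutgoing_iff]
  exact D.oriented h

theorem IsPositive.orientationSign_glue (hD : D.IsPositive) (h : D.HalfEdge) :
    D.orientationSign (D.glue h) = - D.orientationSign h := by
  have := hD.glue_outgoing h
  unfold orientationSign
  revert this
  generalize (D.glue h).2 = i
  generalize h.2 = j
  fin_cases i <;> fin_cases j <;> simp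

/-- The equivalence relation of belonging to the same edge. -/
def edgeSetoid (D : LinkDiagram) : Setoid D.HalfEdge where
  r a b := b = a ∨ b = D.glue a
  iseqv := by
    refine ⟨fun _ => Or.inl rfl, ?_, ?_⟩
    · rintro a b (rfl | rfl)
      · exact Or.inl rfl
      · exact Or.inr (D.glue_glue a).symm
    · rintro a b c (rfl | rfl) (rfl | rfl)
      · exact Or.inl rfl
      · exact Or.inr rfl
      · exact Or.inr rfl
      · exact Or.inl (D.glue_glue a)

/-- The equivalence relation of belonging to the same crossing. -/
def crossingSetoid (D : LinkDiagram) : Setoid D.HalfEdge := Setoid.ker Prod.fst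

theorem card_crossingSetoid : Nat.card (Quotient D.crossingSetoid) = D.n := by
  have hs : Function.Surjective (Prod.fst : D.HalfEdge → Fin D.n) := fun c => ⟨(c, 0), rfl⟩
  rw [crossingSetoid, Nat.card_congr (Setoid.quotientKerEquivOfSurjective _ hs)]
  simp

/-- The 2n outgoing half-edges lie on different edges, since gluing exchanges outgoing and incoming.
Only this inequality is needed in the dimension count. -/
theorem IsPositive.card_edgeSetoid (hD : D.IsPositive) :
    2 * D.n ≤ Nat.card (Quotient D.edgeSetoid) := by
  let u : Fin D.n × Fin 2 → Quotient D.edgeSetoid := fun a =>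
    Quotient.mk _ (a.1, ![1, 2] a.2)
  have hu : Function.Injective u := by
    rintro ⟨c, i⟩ ⟨d, j⟩ h
    rcases Quotient.exact h with h | h
    · simp only [Prod.mk.injEq] at h
      obtain ⟨rfl, h⟩ := h
      fin_cases i <;> fin_cases j <;> simp_all
    · have := hD.glue_outgoing (c, ![1, 2] i)
      rw [← h] at this
      simp only at this
      revert this
      fin_cases i <;> fin_cases j <;> simp
  have := Nat.card_le_card_of_injective u hu
  simpa [mul_comm] using this

theorem rotate_fst (a : D.HalfEdge) : (rotateHalfEdge D.n a).1 = a.1 := rfl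

theorem mem_crossing_iff (f : D.HalfEdge → ℚ) :
    f ∈ invariantFunctions D.crossingSetoid ↔ ∀ h, f (rotateHalfEdge D.n h) = f h := by
  constructor
  · intro hf h
    exact hf _ _ (rotate_fst h)
  · rintro hf ⟨c, i⟩ ⟨d, j⟩ h
    have h' : c = d := h
    subst h'
    have h0 := hf (c, 0)
    have h1 := hf (c, 1)
    have h2 := hf (c, 2)
    simp only [rotateHalfEdge, Equiv.prodCongr_apply, Prod.map, Equiv.refl_apply,
      Equiv.coe_addRight, zero_add] at h0 h1 h2
    change f (c, 2) = _ at h1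
    change f (c, 3) = _ at h2
    fin_cases i <;> fin_cases j <;> simp [h0, h1, h2]

theorem mem_edge_iff (f : D.HalfEdge → ℚ) :
    f ∈ invariantFunctions D.edgeSetoid ↔ ∀ h, f (D.glue h) = f h := by
  constructor
  · intro hf h
    exact (hf _ _ (Or.inr rfl)).symm
  · rintro hf a b (rfl | rfl)
    · rfl
    · exact (hf a).symm

theorem mem_connected_iff (f : D.HalfEdge → ℚ) :
    f ∈ invariantFunctions (connectedSetoid D.glue) ↔
      (∀ h, f (D.glue h) = f h) ∧ ∀ h, f (rotateHalfEdge D.n h) = f h := by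
  constructor
  · intro hf
    exact ⟨fun h => (hf _ _ (Relation.EqvGen.rel _ _ (Or.inl rfl))).symm,
      fun h => (hf _ _ (Relation.EqvGen.rel _ _ (Or.inr rfl))).symm⟩
  · rintro ⟨h1, h2⟩ a b h
    induction h with
    | rel a b h =>
      rcases h with rfl | rfl
      · exact (h1 a).symm
      · exact (h2 a).symm
    | refl => rfl
    | symm _ _ _ ih => exact ih.symm
    | trans _ _ _ _ _ ih1 ih2 => exact ih1.trans ih2

theorem mem_face_iff (f : D.HalfEdge → ℚ) :
    f ∈ invariantFunctions (Equiv.Perm.SameCycle.setoid (facePermutation D.glue)) ↔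
      ∀ h, f (facePermutation D.glue h) = f h := by
  constructor
  · intro hf h
    exact (hf _ _ ⟨1, by simp⟩).symm
  · rintro hf a b ⟨i, rfl⟩
    induction i using Int.induction_on generalizing a with
    | zero => rfl
    | succ i ih =>
      rw [zpow_add, zpow_one, Equiv.Perm.mul_apply, ← ih, hf]
    | pred i ih =>
      rw [zpow_sub, zpow_one, Equiv.Perm.mul_apply, ← ih]
      have := hf ((facePermutation D.glue)⁻¹ a)
      simpa using this

/-- The boundary of a two-chain of faces. -/
def faceBoundary (D : LinkDiagram) :
    invariantFunctions (Equiv.Perm.SameCycle.setoid (facePermutation D.glue)) →ₗ[ℚ]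
      (D.HalfEdge → ℚ) where
  toFun f h := f.1 h - f.1 (D.glue h)
  map_add' f g := by funext h; simp; ring
  map_smul' c f := by funext h; simp; ring

/-- The far end of an edge sees the face on its other side, which at `h` is the clockwise
neighbouring corner. -/
theorem face_glue {f : D.HalfEdge → ℚ} (hf : ∀ h, f (facePermutation D.glue h) = f h)
    (h : D.HalfEdge) : f (D.glue h) = f ((rotateHalfEdge D.n)⁻¹ h) := by
  rw [← hf, facePermutation, Equiv.Perm.mul_apply, D.glue_glue]

/-- A function on faces with no jump across any edge is constant on the components of the diagram.
-/
theorem finrank_ker_faceBoundary :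
    finrank ℚ (LinearMap.ker D.faceBoundary) = Nat.card (Quotient (connectedSetoid D.glue)) := by
  rw [← finrank_invariantFunctions]
  rw [(Submodule.equivSubtypeMap _ (LinearMap.ker D.faceBoundary)).finrank_eq]
  suffices h : (LinearMap.ker D.faceBoundary).map (Submodule.subtype _) =
      invariantFunctions (connectedSetoid D.glue) by rw [h]
  ext f
  rw [mem_connected_iff]
  constructor
  · rintro ⟨⟨f, hf⟩, hk, rfl⟩
    have h1 : ∀ h, f (D.glue h) = f h := fun h => (sub_eq_zero.1 (congrFun hk h)).symm
    refine ⟨h1, fun h => ?_⟩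
    have h2 := face_glue ((mem_face_iff f).1 hf) (rotateHalfEdge D.n h)
    rw [h1] at h2
    simpa using h2
  · rintro ⟨h1, h2⟩
    refine ⟨⟨f, (mem_face_iff f).2 fun h => ?_⟩, ?_, rfl⟩
    · rw [← h1 h, ← h2, facePermutation]
      simp
    · funext h
      exact sub_eq_zero.2 (h1 h).symm

/-- Rank-nullity with F = n + 2C: the rank is F - C. Planarity enters the argument here. -/
theorem finrank_range_faceBoundary :
    finrank ℚ (LinearMap.range D.faceBoundary) =
      D.n + Nat.card (Quotient (connectedSetoid D.glue)) := by
  have h1 := LinearMap.finrank_range_add_finrank_ker D.faceBoundary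
  rw [finrank_ker_faceBoundary, finrank_invariantFunctions, D.planar] at h1
  omega

theorem sum_antisymm_mul_eq_zero {e s : D.HalfEdge → ℚ} (he : ∀ h, e (D.glue h) = - e h)
    (hs : ∀ h, s (D.glue h) = s h) : ∑ h, e h * s h = 0 := by
  have h1 := Equiv.sum_comp D.glue fun h => e h * s h
  simp only [he, hs, neg_mul, Finset.sum_neg_distrib] at h1
  linarith

/-- The functions `s + y` where `s` is constant on edges and `y` is constant at crossings. -/
def edgeSupCrossing (D : LinkDiagram) : Submodule ℚ (D.HalfEdge → ℚ) :=
  invariantFunctions D.edgeSetoid ⊔ invariantFunctions D.crossingSetoid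

theorem IsPositive.finrank_edgeSupCrossing (hD : D.IsPositive) :
    3 * D.n ≤ finrank ℚ D.edgeSupCrossing + Nat.card (Quotient (connectedSetoid D.glue)) := by
  have h1 := Submodule.finrank_sup_add_finrank_inf_eq (invariantFunctions D.edgeSetoid)
    (invariantFunctions D.crossingSetoid)
  have h2 : invariantFunctions D.edgeSetoid ⊓ invariantFunctions D.crossingSetoid =
      invariantFunctions (connectedSetoid D.glue) := by
    ext f
    rw [Submodule.mem_inf, mem_edge_iff, mem_crossing_iff, mem_connected_iff]
  rw [h2, finrank_invariantFunctions, finrank_invariantFunctions, finrank_invariantFunctions,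
    card_crossingSetoid] at h1
  have := hD.card_edgeSetoid
  rw [edgeSupCrossing]
  omega

/-- The hypotheses say that `e` is a 1-cycle: antisymmetric along edges and with zero sum at every
crossing. The annihilator of `edgeSupCrossing` thus plays the role of the space of 1-cycles. -/
theorem mem_dualAnnihilator_of {e : D.HalfEdge → ℚ}
    (h1 : ∀ h, e (D.glue h) = - e h)
    (h2 : ∀ y ∈ invariantFunctions D.crossingSetoid, ∑ h, e h * y h = 0) :
    dotProductEquiv ℚ D.HalfEdge e ∈ D.edgeSupCrossing.dualAnnihilator := by
  rw [Submodule.mem_dualAnnihilator]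
  intro w hw
  obtain ⟨s, hs, y, hy, rfl⟩ := Submodule.mem_sup.1 hw
  rw [map_add]
  have e1 : dotProductEquiv ℚ D.HalfEdge e s = ∑ h, e h * s h := rfl
  have e2 : dotProductEquiv ℚ D.HalfEdge e y = ∑ h, e h * y h := rfl
  rw [e1, e2, h2 y hy, sum_antisymm_mul_eq_zero h1 ((mem_edge_iff s).1 hs), add_zero]

/-- On a union of spheres every 1-cycle is a boundary. Boundaries are cycles, the boundaries have
dimension n + C, and the cycles have dimension at most 4n - (3n - C), so the spaces coincide. The
orientation is a cycle, as two strands enter and two leave each crossing; a primitive of it is an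
Alexander numbering. -/
theorem IsPositive.orientationSign_mem_range (hD : D.IsPositive) :
    D.orientationSign ∈ LinearMap.range D.faceBoundary := by
  let ι := (dotProductEquiv ℚ D.HalfEdge)
  have hle : (LinearMap.range D.faceBoundary).map ι.toLinearMap ≤
      D.edgeSupCrossing.dualAnnihilator := by
    rintro _ ⟨_, ⟨f, rfl⟩, rfl⟩
    have hf := (mem_face_iff f.1).1 f.2
    apply mem_dualAnnihilator_of
    · intro h
      change f.1 _ - f.1 _ = -(f.1 _ - f.1 _)
      rw [D.glue_glue]; ring
    · intro y hy
      rw [mem_crossing_iff] at hy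
      change ∑ h, (f.1 h - f.1 (D.glue h)) * y h = 0
      simp only [face_glue hf, sub_mul, Finset.sum_sub_distrib]
      rw [← Equiv.sum_comp (rotateHalfEdge D.n) fun h => f.1 ((rotateHalfEdge D.n)⁻¹ h) * y h]
      simp [hy]
  have hfin : finrank ℚ D.edgeSupCrossing.dualAnnihilator ≤
      finrank ℚ ((LinearMap.range D.faceBoundary).map ι.toLinearMap) := by
    rw [LinearEquiv.finrank_map_eq ι, finrank_range_faceBoundary]
    have h1 := Subspace.finrank_add_finrank_dualAnnihilator_eq D.edgeSupCrossing
    have h2 := hD.finrank_edgeSupCrossing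
    have h3 : finrank ℚ (D.HalfEdge → ℚ) = 4 * D.n := by
      simp [mul_comm]
    omega
  have heq := Submodule.eq_of_le_of_finrank_le hle hfin
  have hmem : ι D.orientationSign ∈ D.edgeSupCrossing.dualAnnihilator := by
    apply mem_dualAnnihilator_of hD.orientationSign_glue
    intro y hy
    rw [Fintype.sum_prod_type]
    apply Finset.sum_eq_zero
    intro c _
    have hc : ∀ i, y (c, i) = y (c, 0) := fun i => hy _ _ rfl
    simp [Fin.sum_univ_four, orientationSign, hc]
  rw [← heq] at hmem
  obtain ⟨e, he, h⟩ := hmem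
  rwa [← ι.injective h]

/-- The Seifert graph of a positive diagram has no loops. -/
theorem IsPositive.circleOf_ne (hD : D.IsPositive) (c : Fin D.n) :
    D.circleOf D.zeroState (c, 0) ≠ D.circleOf D.zeroState (c, 2) := by
  obtain ⟨f, hf⟩ := hD.orientationSign_mem_range
  have hface := (mem_face_iff f.1).1 f.2
  have hsub : ∀ h, f.1 h - f.1 (D.glue h) = D.orientationSign h := fun h => congrFun hf h
  have hrot : ∀ h, f.1 (rotateHalfEdge D.n h) - f.1 h =
      D.orientationSign (rotateHalfEdge D.n h) := by
    intro h
    rw [← hsub, face_glue hface]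
    simp
  have h1 : ∀ p, f.1 (p, 1) - f.1 (p, 0) = 1 := fun p => hrot (p, 0)
  have h2 : ∀ p, f.1 (p, 2) - f.1 (p, 1) = 1 := fun p => hrot (p, 1)
  have h3 : ∀ p, f.1 (p, 3) - f.1 (p, 2) = -1 := fun p => hrot (p, 2)
  -- The Alexander number of the face to the right of the strand: `f` gives the left face at an
  -- outgoing half-edge, which exceeds the right one by 1, and already the right face at an incoming
  -- one. It is constant along Seifert circles and differs by 1 between the two circles at a
  -- crossing.
  let ρ : D.HalfEdge → ℚ := fun h => if h.2 = 1 ∨ h.2 = 2 then f.1 h - 1 else f.1 h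
  have hglue : ∀ h, ρ (D.glue h) = ρ h := by
    intro h
    have ho := hD.glue_outgoing h
    have hs := hsub h
    simp only [ρ]
    by_cases hh : h.2 = 1 ∨ h.2 = 2
    · rw [if_neg (by tauto), if_pos hh]
      have : D.orientationSign h = 1 := by
        unfold orientationSign
        rcases hh with hh | hh <;> simp [hh]
      linarith
    · rw [if_pos (by tauto), if_neg hh]
      have : D.orientationSign h = -1 := by
        unfold orientationSign
        revert hh
        generalize h.2 = j
        fin_cases j <;> simp
      linarith
  have hsm : ∀ h, ρ (D.smooth D.zeroState h) = ρ h := by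
    rintro ⟨p, i⟩
    have := h1 p
    have := h2 p
    have := h3 p
    fin_cases i <;> simp [ρ, smooth, zeroState] <;> linarith
  have hinv : ∀ a b, D.circleSetoid D.zeroState a b → ρ a = ρ b := by
    intro a b h
    induction h with
    | rel a b h =>
      rcases h with rfl | rfl
      · exact (hglue a).symm
      · exact (hsm a).symm
    | refl => rfl
    | symm _ _ _ ih => exact ih.symm
    | trans _ _ _ _ _ ih1 ih2 => exact ih1.trans ih2
  intro h
  have := hinv _ _ (Quotient.exact (Sum.inl_injective h))
  have e1 := h1 c
  have e2 := h2 c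
  simp [ρ] at this
  linarith

end LinkDiagram

/-! ### Circles of resolutions -/

noncomputable section

namespace LinkDiagram

variable {D : LinkDiagram}

theorem circleOf_eq_iff {s : D.State} {a b : D.HalfEdge} :
    D.circleOf s a = D.circleOf s b ↔ D.circleSetoid s a b :=
  ⟨fun h => Quotient.exact (Sum.inl_injective h), fun h => congrArg Sum.inl (Quotient.sound h)⟩

theorem circleOf_glue (s : D.State) (h : D.HalfEdge) :
    D.circleOf s (D.glue h) = D.circleOf s h :=
  (circleOf_eq_iff.2 (Relation.EqvGen.rel _ _ (Or.inl rfl))).symm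

theorem circleOf_smooth (s : D.State) (h : D.HalfEdge) :
    D.circleOf s (D.smooth s h) = D.circleOf s h :=
  (circleOf_eq_iff.2 (Relation.EqvGen.rel _ _ (Or.inr rfl))).symm

theorem circle_induction {s : D.State} {P : D.Circle s → Prop}
    (h1 : ∀ h, P (D.circleOf s h)) (h2 : ∀ i, P (Sum.inr i)) (a : D.Circle s) : P a := by
  rcases a with q | i
  · induction q using Quotient.ind
    exact h1 _
  · exact h2 i

/-- A property of half-edges that is preserved along the arcs of a resolution is preserved along its
circles. -/
theorem eq_of_circleOf_eq {s : D.State} {α : Type*} {f : D.HalfEdge → α}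
    (h1 : ∀ h, f (D.glue h) = f h) (h2 : ∀ h, f (D.smooth s h) = f h) {a b : D.HalfEdge}
    (h : D.circleOf s a = D.circleOf s b) : f a = f b := by
  replace h := circleOf_eq_iff.1 h
  induction h with
  | rel a b h =>
    rcases h with rfl | rfl
    · exact (h1 a).symm
    · exact (h2 a).symm
  | refl => rfl
  | symm _ _ _ ih => exact ih.symm
  | trans _ _ _ _ _ ih1 ih2 => exact ih1.trans ih2

theorem circleSetoid_le_of {s t : D.State}
    (h : ∀ a, D.circleOf t (D.smooth s a) = D.circleOf t a) :
    D.circleSetoid s ≤ D.circleSetoid t := fun _ _ hab =>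
  circleOf_eq_iff.1 (eq_of_circleOf_eq (circleOf_glue t) h (circleOf_eq_iff.2 hab))

theorem smooth_smooth (s : D.State) (h : D.HalfEdge) : D.smooth s (D.smooth s h) = h := by
  obtain ⟨c, i⟩ := h
  cases hs : s c <;> fin_cases i <;> simp [smooth, hs]

theorem smooth_ne (s : D.State) (h : D.HalfEdge) : D.smooth s h ≠ h := by
  obtain ⟨c, i⟩ := h
  cases hs : s c <;> fin_cases i <;> simp [smooth, hs]

theorem smooth_congr {s t : D.State} {h : D.HalfEdge} (hst : s h.1 = t h.1) :
    D.smooth s h = D.smooth t h := by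
  rw [smooth, smooth, hst]

theorem glue_ne (h : D.HalfEdge) : D.glue h ≠ h := by
  intro hh
  have := D.oriented h
  rw [hh] at this
  tauto

theorem circleOf_one_of_false {s : D.State} {k : Fin D.n} (hs : s k = false) :
    D.circleOf s (k, 1) = D.circleOf s (k, 0) := by
  rw [← circleOf_smooth]
  simp [smooth, hs]

theorem circleOf_three_of_false {s : D.State} {k : Fin D.n} (hs : s k = false) :
    D.circleOf s (k, 3) = D.circleOf s (k, 2) := by
  rw [← circleOf_smooth]
  simp [smooth, hs]

theorem circleOf_one_of_true {s : D.State} {k : Fin D.n} (hs : s k = true) :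
    D.circleOf s (k, 1) = D.circleOf s (k, 2) := by
  rw [← circleOf_smooth]
  simp [smooth, hs]

theorem circleOf_three_of_true {s : D.State} {k : Fin D.n} (hs : s k = true) :
    D.circleOf s (k, 3) = D.circleOf s (k, 0) := by
  rw [← circleOf_smooth]
  simp [smooth, hs]

theorem circleOf_crossing (s : D.State) (k : Fin D.n) (i : Fin 4) :
    D.circleOf s (k, i) = D.circleOf s (k, 0) ∨ D.circleOf s (k, i) = D.circleOf s (k, 2) := by
  cases hs : s k
  · have h1 := circleOf_one_of_false hs
    have h2 := circleOf_three_of_false hs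
    fin_cases i <;> simp [h1, h2]
  · have h1 := circleOf_one_of_true hs
    have h2 := circleOf_three_of_true hs
    fin_cases i <;> simp [h1, h2]

/-- The map from the circles of one resolution to those of another one; it is meaningful if the
circles of the second are unions of arcs of circles of the first. -/
def transfer (D : LinkDiagram) (s t : D.State) : D.Circle s → D.Circle t :=
  Sum.map (fun q => Quotient.mk _ q.out) id

theorem transfer_circleOf {s t : D.State} (hst : D.circleSetoid s ≤ D.circleSetoid t)
    (h : D.HalfEdge) : D.transfer s t (D.circleOf s h) = D.circleOf t h :=
  congrArg Sum.inl (Quotient.sound (hst (Quotient.mk_out (s := D.circleSetoid s) h)))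

theorem transfer_inr (s t : D.State) (i : Fin D.loops) :
    D.transfer s t (Sum.inr i) = Sum.inr i := rfl

theorem transfer_surjective {s t : D.State} (hst : D.circleSetoid s ≤ D.circleSetoid t) :
    Function.Surjective (D.transfer s t) := by
  intro a
  induction a using circle_induction with
  | h1 h => exact ⟨_, transfer_circleOf hst h⟩
  | h2 i => exact ⟨_, transfer_inr s t i⟩

theorem transfer_comp {s t u : D.State} (hst : D.circleSetoid s ≤ D.circleSetoid t)
    (htu : D.circleSetoid t ≤ D.circleSetoid u) :
    D.transfer t u ∘ D.transfer s t = D.transfer s u := by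
  funext a
  induction a using circle_induction with
  | h1 h =>
    rw [Function.comp_apply, transfer_circleOf hst, transfer_circleOf htu,
      transfer_circleOf (hst.trans htu)]
  | h2 i => rfl

/-- All four ends at `k` lie on one circle of `t`, so reconnecting them according to `s` never
leaves a circle of `t`. -/
theorem circleSetoid_le_of_agree {s t : D.State} {k : Fin D.n} (hst : ∀ j, j ≠ k → s j = t j)
    (hk : D.circleOf t (k, 0) = D.circleOf t (k, 2)) :
    D.circleSetoid s ≤ D.circleSetoid t := by
  refine circleSetoid_le_of ?_
  rintro ⟨c, i⟩
  by_cases hc : c = k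
  · subst hc
    have : ∀ j, D.circleOf t (c, j) = D.circleOf t (c, 0) := fun j => by
      rcases circleOf_crossing t c j with h | h
      · exact h
      · rw [h, hk]
    rw [this i]
    exact this _
  · rw [smooth_congr (hst c hc), circleOf_smooth]

/-- Two circles that become the same when the smoothing of `k` is changed are those that pass
by `k`. -/
theorem transfer_eq_iff {s t : D.State} {k : Fin D.n} (hst : ∀ j, j ≠ k → s j = t j)
    (hk : D.circleOf t (k, 0) = D.circleOf t (k, 2)) (a b : D.Circle s) :
    D.transfer s t a = D.transfer s t b ↔ a = b ∨
      (a = D.circleOf s (k, 0) ∨ a = D.circleOf s (k, 2)) ∧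
        (b = D.circleOf s (k, 0) ∨ b = D.circleOf s (k, 2)) := by
  have hle := circleSetoid_le_of_agree hst hk
  constructor
  · intro h
    induction a using circle_induction with
    | h1 a =>
      induction b using circle_induction with
      | h1 b =>
        rw [transfer_circleOf hle, transfer_circleOf hle] at h
        -- Identifying the circles of `s` that pass by `k` gives an invariant that is also constant
        -- along the circles of `t`.
        let f : D.HalfEdge → D.Circle s := fun h =>
          if D.circleOf s h = D.circleOf s (k, 0) ∨ D.circleOf s h = D.circleOf s (k, 2) then
            D.circleOf s (k, 0) else D.circleOf s h
        have hf : f a = f b := by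
          refine eq_of_circleOf_eq (s := t) ?_ ?_ h
          · intro h
            simp only [f, circleOf_glue]
          · rintro ⟨c, i⟩
            by_cases hc : c = k
            · subst hc
              simp only [f]
              rw [if_pos (circleOf_crossing s c i)]
              exact if_pos (circleOf_crossing s c _)
            · rw [← smooth_congr (hst c hc)]
              simp only [f, circleOf_smooth]
        simp only [f] at hf
        split_ifs at hf with h1 h2 h2
        · exact Or.inr ⟨h1, h2⟩
        · exact absurd (Or.inl hf.symm) h2
        · exact absurd (Or.inl hf) h1
        · exact Or.inl hf
      | h2 i =>
        rw [transfer_circleOf hle, transfer_inr] at h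
        exact absurd h Sum.inl_ne_inr
    | h2 i =>
      induction b using circle_induction with
      | h1 b =>
        rw [transfer_circleOf hle, transfer_inr] at h
        exact absurd h Sum.inr_ne_inl
      | h2 j =>
        rw [transfer_inr, transfer_inr] at h
        left
        rw [Sum.inr_injective h]
  · rintro (rfl | ⟨ha, hb⟩)
    · rfl
    · have : ∀ a, (a = D.circleOf s (k, 0) ∨ a = D.circleOf s (k, 2)) →
          D.transfer s t a = D.circleOf t (k, 0) := by
        rintro _ (rfl | rfl)
        · exact transfer_circleOf hle _
        · rw [transfer_circleOf hle, hk]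
      rw [this a ha, this b hb]

theorem even_card_of_involution {α : Type*} (S : Finset α) (f : α → α)
    (h1 : ∀ a ∈ S, f a ∈ S) (h2 : ∀ a, f (f a) = a) (h3 : ∀ a, f a ≠ a) : Even S.card := by
  have h : ∑ _a ∈ S, (1 : ZMod 2) = 0 :=
    Finset.sum_involution (fun a _ => f a) (fun _ _ => by decide) (fun a _ _ => h3 a)
      (fun a ha => h1 a ha) (fun a _ => h2 a)
  rw [Finset.sum_const, nsmul_eq_mul, mul_one] at h
  exact (ZMod.natCast_eq_zero_iff_even).1 h

/-- If a set of half-edges is closed under following the diagram and the smoothings away from `k`,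
it contains an even number of half-edges at `k`. -/
theorem even_card_crossing (s : D.State) (k : Fin D.n) (S : Finset D.HalfEdge)
    (h1 : ∀ a ∈ S, D.glue a ∈ S) (h2 : ∀ a ∈ S, a.1 ≠ k → D.smooth s a ∈ S) :
    Even (S.filter fun a => a.1 = k).card := by
  have e1 := even_card_of_involution S D.glue h1 D.glue_glue glue_ne
  have e2 := even_card_of_involution (S.filter fun a => ¬ a.1 = k) (D.smooth s)
    (fun a ha => by
      rw [Finset.mem_filter] at ha ⊢
      exact ⟨h2 a ha.1 ha.2, ha.2⟩) (smooth_smooth s) (smooth_ne s)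
  rw [← Finset.card_filter_add_card_filter_not (fun a => a.1 = k), Nat.even_add] at e1
  exact e1.2 e2

/-- If two circles pass by `k`, changing the smoothing of `k` merges them. -/
theorem circleOf_eq_of_merge {s t : D.State} {k : Fin D.n} (hst : ∀ j, j ≠ k → s j = t j)
    (hs : s k = false) (ht : t k = true)
    (hne : D.circleOf s (k, 0) ≠ D.circleOf s (k, 2)) :
    D.circleOf t (k, 0) = D.circleOf t (k, 2) := by
  classical
  -- Connectivity with the crossing `k` cut out. By parity the class of `(k, 0)` contains another
  -- end at `k`; the ends 2 and 3 are on the other circle of `s`, so it contains end 1. In `t` end 1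
  -- is then joined to end 2.
  let R : D.HalfEdge → D.HalfEdge → Prop :=
    Relation.EqvGen fun a b => b = D.glue a ∨ (a.1 ≠ k ∧ b = D.smooth s a)
  have hRs : ∀ a b, R a b → D.circleOf s a = D.circleOf s b := by
    intro a b h
    induction h with
    | rel a b h =>
      rcases h with rfl | ⟨_, rfl⟩
      · exact (circleOf_glue s a).symm
      · exact (circleOf_smooth s a).symm
    | refl => rfl
    | symm _ _ _ ih => exact ih.symm
    | trans _ _ _ _ _ ih1 ih2 => exact ih1.trans ih2
  have hRt : ∀ a b, R a b → D.circleOf t a = D.circleOf t b := by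
    intro a b h
    induction h with
    | rel a b h =>
      rcases h with rfl | ⟨hk, rfl⟩
      · exact (circleOf_glue t a).symm
      · rw [smooth_congr (hst _ hk), circleOf_smooth]
    | refl => rfl
    | symm _ _ _ ih => exact ih.symm
    | trans _ _ _ _ _ ih1 ih2 => exact ih1.trans ih2
  have hev := even_card_crossing s k (Finset.univ.filter fun a => R (k, 0) a)
    (fun a ha => by
      rw [Finset.mem_filter] at ha ⊢
      exact ⟨Finset.mem_univ _, ha.2.trans _ _ _ (.rel _ _ (Or.inl rfl))⟩)
    (fun a ha hk => by
      rw [Finset.mem_filter] at ha ⊢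
      exact ⟨Finset.mem_univ _, ha.2.trans _ _ _ (.rel _ _ (Or.inr ⟨hk, rfl⟩))⟩)
  have h1 : R (k, 0) (k, 1) := by
    by_contra hcon
    have : ((Finset.univ.filter fun a => R (k, 0) a).filter fun a => a.1 = k) = {(k, 0)} := by
      ext ⟨c, i⟩
      simp only [Finset.mem_filter, Finset.mem_univ, true_and, Finset.mem_singleton]
      constructor
      · rintro ⟨h, rfl⟩
        have h' := hRs _ _ h
        fin_cases i
        · rfl
        · exact absurd h hcon
        · exact absurd h' hne
        · exact absurd (h'.trans (circleOf_three_of_false hs)) hne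
      · intro h
        exact ⟨h ▸ .refl _, congrArg Prod.fst h⟩
    rw [this] at hev
    simp at hev
  rw [hRt _ _ h1, circleOf_one_of_true ht]

/-! ### Edge maps of the cube: merges and splits -/

section EdgeMap

variable {s t : D.State} {k : Fin D.n}

theorem edgeMap_apply (f : D.VertexGroup s) (y : D.Labelling t) :
    D.edgeMap s t k f y = ∑ x, D.edgeCoeff s t k x y * f x := rfl

/-- The map of an edge of the cube at which two circles merge. -/
theorem edgeMap_eq_pushMap (hst : ∀ j, j ≠ k → s j = t j)
    (hs : s k = false) (ht : t k = true)
    (hne : D.circleOf s (k, 0) ≠ D.circleOf s (k, 2)) :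
    D.edgeMap s t k = pushMap (D.transfer s t) := by
  classical
  have hk := circleOf_eq_of_merge hst hs ht hne
  have hle := circleSetoid_le_of_agree hst hk
  have hc : ∀ x y, D.edgeCoeff s t k x y = pushCoeff (D.transfer s t) x y := by
    intro x y
    rw [pushCoeff_merge (transfer_surjective hle) hne (transfer_eq_iff hst hk), edgeCoeff,
      if_pos hne, transfer_circleOf hle]
    congr 1
    rw [eq_iff_iff]
    constructor
    · rintro ⟨h1, h2⟩ a
      induction a using circle_induction with
      | h1 h => rw [transfer_circleOf hle]; exact h2 h
      | h2 i => rw [transfer_inr]; exact fun _ _ => h1 i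
    · intro h
      refine ⟨fun i => h _ Sum.inr_ne_inl Sum.inr_ne_inl, fun a h1 h2 => ?_⟩
      rw [h _ h1 h2, transfer_circleOf hle]
  apply LinearMap.ext
  intro f
  funext y
  simp only [edgeMap_apply, pushMap_apply, hc]

/-- The map of an edge of the cube at which a circle splits. -/
theorem edgeMap_injective_of_split (hst : ∀ j, j ≠ k → s j = t j)
    (heq : D.circleOf s (k, 0) = D.circleOf s (k, 2))
    (hne : D.circleOf t (k, 0) ≠ D.circleOf t (k, 2)) :
    Function.Injective (D.edgeMap s t k) := by
  classical
  have hts : ∀ j, j ≠ k → t j = s j := fun j hj => (hst j hj).symm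
  have hle : D.circleSetoid t ≤ D.circleSetoid s := circleSetoid_le_of_agree hts heq
  rw [← LinearMap.ker_eq_bot, LinearMap.ker_eq_bot']
  intro f hf
  funext y
  -- Putting v₋ on the second new circle applies the counit: the coefficient of α ↦ β ⊗ v₋ in Δ is 1
  -- if α = β and 0 otherwise. The coefficient of the image at `z` is therefore exactly `f y`.
  let z : D.Labelling t := fun a =>
    if a = D.circleOf t (k, 0) then y (D.circleOf s (k, 0)) else
      if a = D.circleOf t (k, 2) then false else y (D.transfer t s a)
  have hz0 : z (D.circleOf t (k, 0)) = y (D.circleOf s (k, 0)) := if_pos rfl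
  have hz2 : z (D.circleOf t (k, 2)) = false := (if_neg hne.symm).trans (if_pos rfl)
  have hzh : ∀ h, D.circleOf s h ≠ D.circleOf s (k, 0) →
      z (D.circleOf t h) = y (D.circleOf s h) := by
    intro h hh
    simp only [z]
    have h1 : D.circleOf t h ≠ D.circleOf t (k, 0) := fun e => hh (by
      rw [← transfer_circleOf hle, e, transfer_circleOf hle])
    have h2 : D.circleOf t h ≠ D.circleOf t (k, 2) := fun e => hh (by
      rw [← transfer_circleOf hle, e, transfer_circleOf hle, heq])
    rw [if_neg h1, if_neg h2, transfer_circleOf hle]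
  have hzi : ∀ i, z (Sum.inr i) = y (Sum.inr i) := by
    intro i
    exact (if_neg Sum.inr_ne_inl).trans (if_neg Sum.inr_ne_inl)
  have hcoeff : ∀ x, D.edgeCoeff s t k x z = if x = y then 1 else 0 := by
    intro x
    have hcom : ∀ α β, comulCoeff α β false = if α = β then 1 else 0 := by decide
    rw [edgeCoeff, if_neg (not_not.2 heq), hz0, hz2, hcom, ← ite_and]
    congr 1
    rw [eq_iff_iff]
    constructor
    · rintro ⟨⟨h1, h2⟩, h3⟩
      funext a
      induction a using circle_induction with
      | h1 h =>
        by_cases hh : D.circleOf s h = D.circleOf s (k, 0)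
        · rw [hh, h3]
        · rw [h2 h hh (heq ▸ hh), hzh h hh]
      | h2 i => rw [h1, hzi]
    · rintro rfl
      exact ⟨⟨fun i => (hzi i).symm, fun h hh _ => (hzh h hh).symm⟩, rfl⟩
  have := congrFun hf z
  rw [edgeMap_apply] at this
  simpa [hcoeff] using this

end EdgeMap

end LinkDiagram

end

/-! ### Parallel crossings -/

/-- The arc of a cycle from `a` to the element before `b`. -/
theorem exists_cycle_segment {α : Type*} [Finite α] (σ : Equiv.Perm α) {a b : α} (hab : a ≠ b)
    (h : σ.SameCycle a b) :
    ∃ P : Set α, a ∈ P ∧ b ∉ P ∧ σ.symm a ∉ P ∧ σ.symm b ∈ P ∧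
      (∀ x, σ x ≠ a → σ x ≠ b → (σ x ∈ P ↔ x ∈ P)) ∧ ∀ x ∈ P, σ.SameCycle a x := by
  classical
  have hex : ∃ i : ℕ, (σ ^ i) a = b := by
    obtain ⟨i, _, hi⟩ := h.exists_pow_eq'
    exact ⟨i, hi⟩
  let j := Nat.find hex
  have hj : (σ ^ j) a = b := Nat.find_spec hex
  have hmin : ∀ i < j, (σ ^ i) a ≠ b := fun i hi => Nat.find_min hex hi
  have hj0 : j ≠ 0 := by
    intro h0
    rw [h0] at hj
    exact hab hj
  obtain ⟨m, hm⟩ := Nat.exists_eq_succ_of_ne_zero hj0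
  have hsucc : ∀ i x, σ x = (σ ^ (i + 1)) a ↔ x = (σ ^ i) a := by
    intro i x
    rw [pow_succ', Equiv.Perm.mul_apply]
    exact σ.injective.eq_iff
  refine ⟨{x | ∃ i < j, (σ ^ i) a = x}, ⟨0, Nat.pos_of_ne_zero hj0, rfl⟩, ?_, ?_, ?_, ?_, ?_⟩
  · rintro ⟨i, hi, h⟩
    exact hmin i hi h
  · rintro ⟨i, hi, h⟩
    -- If the arc contained the predecessor of `a`, the cycle would close before reaching `b`, and
    -- `b` would have occurred earlier than step `j`.
    have h1 : (σ ^ (i + 1)) a = a := by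
      rw [pow_succ', Equiv.Perm.mul_apply, h, Equiv.apply_symm_apply]
    have h2 : (σ ^ (j - (i + 1))) a = b := by
      conv_lhs => rw [← h1]
      rw [← Equiv.Perm.mul_apply, ← pow_add, Nat.sub_add_cancel hi, hj]
    exact hmin _ (by omega) h2
  · refine ⟨m, by omega, ?_⟩
    rw [Equiv.eq_symm_apply, ← Equiv.Perm.mul_apply, ← pow_succ', ← hj, hm]
  · intro x hxa hxb
    constructor
    · rintro ⟨i, hi, h⟩
      rcases i with _ | i
      · exact absurd h.symm hxa
      · exact ⟨i, by omega, ((hsucc i x).1 h.symm).symm⟩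
    · rintro ⟨i, hi, h⟩
      have h' := (hsucc i x).2 h.symm
      refine ⟨i + 1, ?_, h'.symm⟩
      rcases Nat.lt_or_ge (i + 1) j with h1 | h1
      · exact h1
      · exact absurd (by rw [h', ← hj]; congr 2; omega) hxb
  · rintro x ⟨i, _, rfl⟩
    exact ⟨i, by simp⟩

theorem sameCycle_symm_apply {α : Type*} (σ : Equiv.Perm α) (x : α) :
    σ.SameCycle (σ.symm x) x := ⟨1, by simp⟩

/-- The union of arcs of two different cycles, from `a` to the element before `b` and from `a'` to
the element before `b'`. -/
theorem exists_cycle_segment_pair {α : Type*} [Finite α] (σ : Equiv.Perm α) {a b a' b' : α}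
    (hab : a ≠ b) (hab' : a' ≠ b') (h : σ.SameCycle a b) (h' : σ.SameCycle a' b')
    (hne : ¬ σ.SameCycle a a') :
    ∃ P : Set α, a ∈ P ∧ a' ∈ P ∧ b ∉ P ∧ b' ∉ P ∧ σ.symm a ∉ P ∧ σ.symm a' ∉ P ∧
      σ.symm b ∈ P ∧ σ.symm b' ∈ P ∧
      ∀ x, σ x ≠ a → σ x ≠ b → σ x ≠ a' → σ x ≠ b' → (σ x ∈ P ↔ x ∈ P) := by
  obtain ⟨P, h1, h2, h3, h4, h5, h6⟩ := exists_cycle_segment σ hab h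
  obtain ⟨Q, k1, k2, k3, k4, k5, k6⟩ := exists_cycle_segment σ hab' h'
  have hsymm := sameCycle_symm_apply σ
  refine ⟨P ∪ Q, Or.inl h1, Or.inr k1, ?_, ?_, ?_, ?_, Or.inl h4, Or.inr k4, ?_⟩
  · rintro (hx | hx)
    · exact h2 hx
    · exact hne (h.trans (k6 _ hx).symm)
  · rintro (hx | hx)
    · exact hne ((h6 _ hx).trans h'.symm)
    · exact k2 hx
  · rintro (hx | hx)
    · exact h3 hx
    · exact hne ((hsymm a).symm.trans (k6 _ hx).symm)
  · rintro (hx | hx)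
    · exact hne ((h6 _ hx).trans (hsymm a'))
    · exact k3 hx
  · intro x e1 e2 e3 e4
    rw [Set.mem_union, Set.mem_union, h5 x e1 e2, k5 x e3 e4]

/-! ### Seifert circles as oriented cycles, and parallel crossings -/

noncomputable section

namespace LinkDiagram

variable {D : LinkDiagram}

/-- The permutation that follows an outgoing half-edge to the next crossing and leaves it along the
Seifert smoothing. -/
def seifertPerm (D : LinkDiagram) : Equiv.Perm D.HalfEdge :=
  D.glue.trans (Function.Involutive.toPerm (D.smooth D.zeroState) (smooth_smooth _))

theorem seifertPerm_apply (h : D.HalfEdge) :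
    D.seifertPerm h = D.smooth D.zeroState (D.glue h) := rfl

theorem seifertPerm_symm_apply (h : D.HalfEdge) :
    D.seifertPerm.symm h = D.glue (D.smooth D.zeroState h) := by
  rw [Equiv.symm_apply_eq, seifertPerm_apply, D.glue_glue, smooth_smooth]

open Classical in
/-- The outgoing half of the edge of a half-edge of a positive diagram. -/
def outgoingHalf (D : LinkDiagram) (h : D.HalfEdge) : D.HalfEdge :=
  if h.2 = 1 ∨ h.2 = 2 then h else D.glue h

theorem IsPositive.outgoingHalf_glue (hD : D.IsPositive) (h : D.HalfEdge) :
    D.outgoingHalf (D.glue h) = D.outgoingHalf h := by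
  have := hD.glue_outgoing h
  rw [outgoingHalf, outgoingHalf]
  by_cases hh : h.2 = 1 ∨ h.2 = 2
  · rw [if_neg (by tauto), if_pos hh, D.glue_glue]
  · rw [if_pos (by tauto), if_neg hh]

theorem outgoingHalf_one (c : Fin D.n) : D.outgoingHalf (c, 1) = (c, 1) := by simp [outgoingHalf]

theorem outgoingHalf_two (c : Fin D.n) : D.outgoingHalf (c, 2) = (c, 2) := by simp [outgoingHalf]

theorem outgoingHalf_zero (c : Fin D.n) :
    D.outgoingHalf (c, 0) = D.seifertPerm.symm (c, 1) := by
  rw [seifertPerm_symm_apply]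
  simp [outgoingHalf, smooth, zeroState]

theorem outgoingHalf_three (c : Fin D.n) :
    D.outgoingHalf (c, 3) = D.seifertPerm.symm (c, 2) := by
  rw [seifertPerm_symm_apply]
  simp [outgoingHalf, smooth, zeroState]

/-- `seifertPerm` also has cycles of incoming half-edges, running backwards. Representing each edge
by its outgoing half makes every Seifert circle through crossings a single cycle. -/
theorem IsPositive.sameCycle_of_circleOf_eq (hD : D.IsPositive) {a b : D.HalfEdge}
    (h : D.circleOf D.zeroState a = D.circleOf D.zeroState b) :
    D.seifertPerm.SameCycle (D.outgoingHalf a) (D.outgoingHalf b) := by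
  let f : D.HalfEdge → Quotient (Equiv.Perm.SameCycle.setoid D.seifertPerm) := fun h =>
    Quotient.mk _ (D.outgoingHalf h)
  have : f a = f b := by
    refine eq_of_circleOf_eq (s := D.zeroState) ?_ ?_ h
    · intro h
      simp only [f, hD.outgoingHalf_glue]
    · rintro ⟨c, i⟩
      apply Quotient.sound
      change D.seifertPerm.SameCycle _ _
      have h1 := sameCycle_symm_apply D.seifertPerm (c, 1)
      have h2 := sameCycle_symm_apply D.seifertPerm (c, 2)
      rw [← outgoingHalf_zero] at h1
      rw [← outgoingHalf_three] at h2
      fin_cases i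
      · simpa [smooth, zeroState, outgoingHalf_one] using h1.symm
      · simpa [smooth, zeroState, outgoingHalf_one] using h1
      · simpa [smooth, zeroState, outgoingHalf_two] using h2
      · simpa [smooth, zeroState, outgoingHalf_two] using h2.symm
  exact Quotient.exact this

theorem circleOf_seifertPerm (h : D.HalfEdge) :
    D.circleOf D.zeroState (D.seifertPerm h) = D.circleOf D.zeroState h := by
  rw [seifertPerm_apply, circleOf_smooth, circleOf_glue]

theorem circleOf_eq_of_sameCycle {a b : D.HalfEdge} (h : D.seifertPerm.SameCycle a b) :
    D.circleOf D.zeroState a = D.circleOf D.zeroState b := by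
  obtain ⟨i, hi, rfl⟩ := h.exists_pow_eq'
  clear hi h
  induction i with
  | zero => rfl
  | succ i ih => rw [pow_succ', Equiv.Perm.mul_apply, circleOf_seifertPerm, ih]

/-- The ends of the edge of the state graph `G₀(D)` given by a crossing. -/
def chord (D : LinkDiagram) (c : Fin D.n) : Sym2 (D.Circle D.zeroState) :=
  s(D.circleOf D.zeroState (c, 0), D.circleOf D.zeroState (c, 2))

/-- The half-edges on one of the two circles at parallel crossings with marker `1`. -/
theorem IsPositive.exists_separating (hD : D.IsPositive) {c d : Fin D.n} (hcd : c ≠ d)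
    (hpar : D.chord c = D.chord d) {t : D.State} (ht : ∀ j, t j = true ↔ j = c ∨ j = d) :
    ∃ f : D.HalfEdge → Prop, (∀ h, f (D.glue h) = f h) ∧ (∀ h, f (D.smooth t h) = f h) ∧
      ¬ f (c, 0) ∧ f (c, 2) ∧ f (d, 0) ∧ ¬ f (d, 2) := by
  have hz : ∀ k : Fin D.n, D.zeroState k = false := fun _ => rfl
  have hc12 : ¬ D.seifertPerm.SameCycle (c, 1) (c, 2) := by
    intro h
    apply hD.circleOf_ne c
    rw [← circleOf_one_of_false (hz c), circleOf_eq_of_sameCycle h]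
  have hcyc : ∀ a b, D.circleOf D.zeroState a = D.circleOf D.zeroState b →
      D.outgoingHalf a = a → D.outgoingHalf b = b → D.seifertPerm.SameCycle a b := by
    intro a b h h1 h2
    have := hD.sameCycle_of_circleOf_eq h
    rwa [h1, h2] at this
  -- `P` is the union of the arcs from `c` to `d` on the two circles. At `c` both outgoing edges are
  -- in `P` and both incoming ones are not; at `d` it is the reverse. The marker 1 joins outgoing to
  -- outgoing and incoming to incoming, so membership in `P` is constant along the circles of `t`.
  obtain ⟨P, p1, p2, p3, p4, p5, p6, p7, p8, p9⟩ : ∃ P : Set D.HalfEdge,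
      (c, 1) ∈ P ∧ (c, 2) ∈ P ∧ (d, 1) ∉ P ∧ (d, 2) ∉ P ∧
      D.seifertPerm.symm (c, 1) ∉ P ∧ D.seifertPerm.symm (c, 2) ∉ P ∧
      D.seifertPerm.symm (d, 1) ∈ P ∧ D.seifertPerm.symm (d, 2) ∈ P ∧
      ∀ x, (D.seifertPerm x).1 ≠ c → (D.seifertPerm x).1 ≠ d →
        (D.seifertPerm x ∈ P ↔ x ∈ P) := by
    have hne : ∀ i j, ((c, i) : D.HalfEdge) ≠ (d, j) := fun i j h => hcd (congrArg Prod.fst h)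
    rcases Sym2.eq_iff.1 hpar with ⟨h1, h2⟩ | ⟨h1, h2⟩
    · rw [← circleOf_one_of_false (hz c), ← circleOf_one_of_false (hz d)] at h1
      obtain ⟨P, q1, q2, q3, q4, q5, q6, q7, q8, q9⟩ := exists_cycle_segment_pair D.seifertPerm
        (hne 1 1) (hne 2 2) (hcyc _ _ h1 (outgoingHalf_one c) (outgoingHalf_one d))
        (hcyc _ _ h2 (outgoingHalf_two c) (outgoingHalf_two d)) hc12
      exact ⟨P, q1, q2, q3, q4, q5, q6, q7, q8, fun x hc hd => q9 x (fun e => hc (by rw [e]))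
        (fun e => hd (by rw [e])) (fun e => hc (by rw [e])) (fun e => hd (by rw [e]))⟩
    · rw [← circleOf_one_of_false (hz c)] at h1
      rw [← circleOf_one_of_false (hz d)] at h2
      obtain ⟨P, q1, q2, q3, q4, q5, q6, q7, q8, q9⟩ := exists_cycle_segment_pair D.seifertPerm
        (hne 1 2) (hne 2 1) (hcyc _ _ h1 (outgoingHalf_one c) (outgoingHalf_two d))
        (hcyc _ _ h2 (outgoingHalf_two c) (outgoingHalf_one d)) hc12
      exact ⟨P, q1, q2, q4, q3, q5, q6, q8, q7, fun x hc hd => q9 x (fun e => hc (by rw [e]))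
        (fun e => hd (by rw [e])) (fun e => hc (by rw [e])) (fun e => hd (by rw [e]))⟩
  refine ⟨fun h => D.outgoingHalf h ∈ P, fun h => ?_, ?_, ?_, ?_, ?_, ?_⟩
  · simp only [hD.outgoingHalf_glue]
  · rintro ⟨k, i⟩
    by_cases hk : k = c ∨ k = d
    · have _htk := (ht k).2 hk
      rcases hk with rfl | rfl <;> fin_cases i <;>
        simp [smooth, outgoingHalf_zero, outgoingHalf_one, outgoingHalf_two,
          outgoingHalf_three, *]
    · have htk : t k = false := by
        rw [← Bool.not_eq_true, ht]
        exact hk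
      push Not at hk
      have e1 := p9 (D.seifertPerm.symm (k, 1)) (by simpa using hk.1) (by simpa using hk.2)
      have e2 := p9 (D.seifertPerm.symm (k, 2)) (by simpa using hk.1) (by simpa using hk.2)
      rw [Equiv.apply_symm_apply] at e1 e2
      fin_cases i <;>
        simp [smooth, htk, outgoingHalf_zero, outgoingHalf_one, outgoingHalf_two,
          outgoingHalf_three, e1, e2]
  · simpa only [outgoingHalf_zero] using p5
  · simpa only [outgoingHalf_two] using p2
  · simpa only [outgoingHalf_zero] using p7
  · simpa only [outgoingHalf_two] using p4

end LinkDiagram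

end

/-! ### The bottom of the cube of resolutions -/

noncomputable section

open Classical in
/-- The kernel of the map that multiplies the tensor factors at the ends of `e` and those at the
ends of `e'`. -/
def mergeKernel {X : Type*} [Fintype X] [DecidableEq X] (e e' : Sym2 X) :
    Submodule ℤ ((X → Bool) → ℤ) :=
  LinearMap.ker (pushMap (Quot.mk fun a b : X => (a ∈ e ∧ b ∈ e) ∨ (a ∈ e' ∧ b ∈ e')))

section MergeKernel

universe u v

variable {X : Type u} {Y : Type v} [Fintype X] [DecidableEq X]

/-- `p` has the universal property of the quotient that collapses `e` and `e'`. Test targets `W :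
Type u` suffice, because that quotient lives in the universe of `X`. -/
theorem ker_pushMap_eq_mergeKernel [Fintype Y] [DecidableEq Y]
    {e e' : Sym2 X} {p : X → Y} (hp : Function.Surjective p)
    (h1 : ∀ a b, (a ∈ e ∧ b ∈ e) ∨ (a ∈ e' ∧ b ∈ e') → p a = p b)
    (h2 : ∀ {W : Type u} (q : X → W),
      (∀ a b, (a ∈ e ∧ b ∈ e) ∨ (a ∈ e' ∧ b ∈ e') → q a = q b) → ∀ a b, p a = p b → q a = q b) :
    LinearMap.ker (pushMap p) = mergeKernel e e' := by
  classical
  have := Fintype.ofFinite (Quot fun a b : X => (a ∈ e ∧ b ∈ e) ∨ (a ∈ e' ∧ b ∈ e'))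
  apply le_antisymm
  · exact ker_pushMap_le hp (h2 _ fun a b h => Quot.sound h)
  · apply ker_pushMap_le Quot.mk_surjective
    intro a b h
    exact congrArg (Quot.lift p h1) h

theorem mem_mergeKernel_map [Fintype Y] [DecidableEq Y] (θ : X ≃ Y)
    (e e' : Sym2 X) (f : (X → Bool) → ℤ) :
    pushMap θ f ∈ mergeKernel (e.map θ) (e'.map θ) ↔ f ∈ mergeKernel e e' := by
  classical
  let R := fun a b : Y => (a ∈ e.map θ ∧ b ∈ e.map θ) ∨ (a ∈ e'.map θ ∧ b ∈ e'.map θ)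
  have := Fintype.ofFinite (Quot R)
  have hm : ∀ (e : Sym2 X) a, θ a ∈ e.map θ ↔ a ∈ e := by
    intro e a
    simp [Sym2.mem_map]
  rw [← ker_pushMap_eq_mergeKernel (p := Quot.mk R ∘ θ)
    (Quot.mk_surjective.comp θ.surjective), mergeKernel, LinearMap.mem_ker, LinearMap.mem_ker,
    pushMap_pushMap]
  · intro a b h
    apply Quot.sound
    simpa only [R, hm] using h
  · intro W q hq a b h
    have hl : ∀ a b, R a b → q (θ.symm a) = q (θ.symm b) := by
      intro a b h
      apply hq
      rw [← hm e, ← hm e, ← hm e', ← hm e']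
      simpa only [Equiv.apply_symm_apply] using h
    have := congrArg (Quot.lift (fun a => q (θ.symm a)) hl) h
    simpa using this

theorem pushMap_equiv_apply (θ : X ≃ Y) (f : (X → Bool) → ℤ) (y : Y → Bool) :
    pushMap θ f y = f (y ∘ θ) := by
  rw [pushMap_apply, Finset.sum_eq_single (y ∘ θ)]
  · rw [pushCoeff, if_pos, one_mul]
    refine ⟨fun a ha => ha, θ.injective.injOn, fun b hb => ⟨θ.symm b, ?_, by simp⟩⟩
    simpa using hb
  · intro x _ hx
    rw [pushCoeff, if_neg, zero_mul]
    intro h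
    apply hx
    funext a
    have h1 : x a = false → y (θ a) = false := fun ha => h.mapsTo ha
    have h2 : y (θ a) = false → x a = false := by
      intro hy
      obtain ⟨b, hb, hba⟩ := h.surjOn hy
      rwa [← θ.injective hba]
    rw [Function.comp_apply]
    cases h3 : x a <;> cases h4 : y (θ a) <;> simp_all
  · simp

end MergeKernel

namespace LinkDiagram

variable {D : LinkDiagram}

/-- The state with a single marker `1`. -/
def oneState (D : LinkDiagram) (c : Fin D.n) : D.State := Function.update D.zeroState c true

theorem oneState_self (c : Fin D.n) : D.oneState c c = true := Function.update_self ..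

theorem oneState_of_ne {c j : Fin D.n} (h : j ≠ c) : D.oneState c j = false :=
  Function.update_of_ne h ..

theorem IsPositive.circleOf_oneState (hD : D.IsPositive) (c : Fin D.n) :
    D.circleOf (D.oneState c) (c, 0) = D.circleOf (D.oneState c) (c, 2) :=
  circleOf_eq_of_merge (fun _ hj => (oneState_of_ne hj).symm) rfl (oneState_self c)
    (hD.circleOf_ne c)

theorem IsPositive.zeroState_le_oneState (hD : D.IsPositive) (c : Fin D.n) :
    D.circleSetoid D.zeroState ≤ D.circleSetoid (D.oneState c) :=
  circleSetoid_le_of_agree (fun _ hj => (oneState_of_ne hj).symm) (hD.circleOf_oneState c)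

theorem IsPositive.transfer_oneState_eq_iff (hD : D.IsPositive) (c : Fin D.n)
    (a b : D.Circle D.zeroState) :
    D.transfer D.zeroState (D.oneState c) a = D.transfer D.zeroState (D.oneState c) b ↔
      a = b ∨ (a ∈ D.chord c ∧ b ∈ D.chord c) := by
  rw [chord, Sym2.mem_iff, Sym2.mem_iff]
  exact transfer_eq_iff (fun _ hj => (oneState_of_ne hj).symm) (hD.circleOf_oneState c) a b

theorem IsPositive.edgeMap_zeroState (hD : D.IsPositive) (c : Fin D.n) :
    D.edgeMap D.zeroState (D.oneState c) c = pushMap (D.transfer D.zeroState (D.oneState c)) :=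
  edgeMap_eq_pushMap (fun _ hj => (oneState_of_ne hj).symm) rfl (oneState_self c)
    (hD.circleOf_ne c)

theorem IsPositive.edgeMap_zeroState_surjective (hD : D.IsPositive) (c : Fin D.n) :
    Function.Surjective (D.edgeMap D.zeroState (D.oneState c) c) := by
  rw [hD.edgeMap_zeroState]
  exact pushMap_surjective (transfer_surjective (hD.zeroState_le_oneState c))

theorem IsPositive.ker_edgeMap_zeroState (hD : D.IsPositive) (c : Fin D.n) :
    LinearMap.ker (D.edgeMap D.zeroState (D.oneState c) c) =
      mergeKernel (D.chord c) (D.chord c) := by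
  rw [hD.edgeMap_zeroState]
  apply ker_pushMap_eq_mergeKernel (transfer_surjective (hD.zeroState_le_oneState c))
  · intro a b h
    rw [hD.transfer_oneState_eq_iff]
    tauto
  · intro W q hq a b h
    rcases (hD.transfer_oneState_eq_iff c a b).1 h with rfl | h
    · rfl
    · exact hq a b (Or.inl h)

/-- A second crossing joins the same circles as the first if and only if it is parallel to it. -/
theorem IsPositive.circleOf_oneState_eq_iff (hD : D.IsPositive) (c d : Fin D.n) :
    D.circleOf (D.oneState c) (d, 0) = D.circleOf (D.oneState c) (d, 2) ↔
      D.chord c = D.chord d := by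
  rw [← transfer_circleOf (hD.zeroState_le_oneState c),
    ← transfer_circleOf (hD.zeroState_le_oneState c), hD.transfer_oneState_eq_iff,
    Sym2.mem_and_mem_iff (hD.circleOf_ne d), chord, chord]
  exact or_iff_right (hD.circleOf_ne d)

theorem IsPositive.oneState_le_of_parallel (hD : D.IsPositive) {c d : Fin D.n}
    (h : D.chord c = D.chord d) :
    D.circleSetoid (D.oneState c) ≤ D.circleSetoid (D.oneState d) := by
  intro a b hab
  rw [← circleOf_eq_iff, ← transfer_circleOf (hD.zeroState_le_oneState d),
    ← transfer_circleOf (hD.zeroState_le_oneState d), hD.transfer_oneState_eq_iff, ← h,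
    ← hD.transfer_oneState_eq_iff, transfer_circleOf (hD.zeroState_le_oneState c),
    transfer_circleOf (hD.zeroState_le_oneState c), circleOf_eq_iff]
  exact hab

theorem IsPositive.circleOf_oneState_of_parallel (hD : D.IsPositive) {c d : Fin D.n}
    (h : D.chord c = D.chord d) :
    D.circleOf (D.oneState c) (c, 0) = D.circleOf (D.oneState c) (d, 0) := by
  have hmem : D.circleOf D.zeroState (d, 0) ∈ D.chord c := by
    rw [h]
    exact Sym2.mem_mk_left _ _
  rw [← transfer_circleOf (hD.zeroState_le_oneState c),
    ← transfer_circleOf (hD.zeroState_le_oneState c), hD.transfer_oneState_eq_iff]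
  exact Or.inr ⟨Sym2.mem_mk_left _ _, hmem⟩

/-! ### Squares at the bottom of the cube -/

section TwoCrossings

variable {c d : Fin D.n} {t : D.State}

theorem agree_of_update (ht : t = Function.update (D.oneState c) d true) :
    ∀ j, j ≠ d → D.oneState c j = t j := by
  rintro j hj
  rw [ht, Function.update_of_ne hj]

theorem update_oneState_comm (hcd : c ≠ d) :
    Function.update (D.oneState c) d true = Function.update (D.oneState d) c true :=
  Function.update_comm hcd _ _ _

theorem eq_true_iff_of_update (ht : t = Function.update (D.oneState c) d true) (j : Fin D.n) :
    t j = true ↔ j = c ∨ j = d := by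
  subst ht
  by_cases hd : j = d
  · subst hd; simp
  · rw [Function.update_of_ne hd]
    by_cases hc : j = c
    · subst hc; simp [oneState_self]
    · simp [oneState_of_ne hc, hc, hd]

theorem IsPositive.circleOf_ne_of_parallel (hD : D.IsPositive) (hcd : c ≠ d)
    (hpar : D.chord c = D.chord d) (ht : t = Function.update (D.oneState c) d true) :
    D.circleOf t (d, 0) ≠ D.circleOf t (d, 2) := by
  obtain ⟨f, h1, h2, -, -, h5, h6⟩ := hD.exists_separating hcd hpar (eq_true_iff_of_update ht)
  intro h
  have := eq_of_circleOf_eq h1 h2 h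
  rw [this] at h5
  exact h6 h5

/-- The map of the cube at the second of two parallel crossings. -/
theorem IsPositive.edgeMap_injective_of_parallel (hD : D.IsPositive) (hcd : c ≠ d)
    (hpar : D.chord c = D.chord d) (ht : t = Function.update (D.oneState c) d true) :
    Function.Injective (D.edgeMap (D.oneState c) t d) :=
  edgeMap_injective_of_split (agree_of_update ht) ((hD.circleOf_oneState_eq_iff c d).2 hpar)
    (hD.circleOf_ne_of_parallel hcd hpar ht)

/-- Each end lies on one of the two halves of the split circle, and the separating function tells
which. The halves appear in opposite order at `c` and at `d`. -/
theorem IsPositive.circleOf_eq_of_parallel (hD : D.IsPositive) (hcd : c ≠ d)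
    (hpar : D.chord c = D.chord d) (ht : t = Function.update (D.oneState c) d true) :
    D.circleOf t (c, 0) = D.circleOf t (d, 2) ∧ D.circleOf t (c, 2) = D.circleOf t (d, 0) := by
  obtain ⟨f, h1, h2, h3, h4, h5, h6⟩ := hD.exists_separating hcd hpar (eq_true_iff_of_update ht)
  have hk := (hD.circleOf_oneState_eq_iff c d).2 hpar
  have hagree : ∀ j, j ≠ d → t j = D.oneState c j := fun j hj => (agree_of_update ht j hj).symm
  have hle := circleSetoid_le_of_agree hagree hk
  have hcd' : ∀ i, (i = 0 ∨ i = 2) → D.circleOf (D.oneState c) (c, i) =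
      D.circleOf (D.oneState c) (d, 0) := by
    rintro i (rfl | rfl)
    · exact hD.circleOf_oneState_of_parallel hpar
    · rw [← hD.circleOf_oneState, hD.circleOf_oneState_of_parallel hpar]
  have hmem : ∀ i, (i = 0 ∨ i = 2) → D.circleOf t (c, i) = D.circleOf t (d, 0) ∨
      D.circleOf t (c, i) = D.circleOf t (d, 2) := by
    intro i hi
    have h := hcd' i hi
    rw [← transfer_circleOf hle, ← transfer_circleOf hle, transfer_eq_iff hagree hk] at h
    rcases h with h | ⟨h, -⟩
    · exact Or.inl h
    · exact h
  constructor
  · rcases hmem 0 (Or.inl rfl) with h | h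
    · have := eq_of_circleOf_eq h1 h2 h
      rw [this] at h3
      exact absurd h5 h3
    · exact h
  · rcases hmem 2 (Or.inr rfl) with h | h
    · exact h
    · have := eq_of_circleOf_eq h1 h2 h
      rw [this] at h4
      exact absurd h4 h6

/-- Either crossing alone merges the same two circles, and the other one then splits the result into
the same two halves. These are listed in opposite orders, so cocommutativity of Δ gives the
equality. -/
theorem IsPositive.edgeMap_comp_of_parallel (hD : D.IsPositive) (hcd : c ≠ d)
    (hpar : D.chord c = D.chord d) (ht : t = Function.update (D.oneState c) d true)
    (f : D.VertexGroup D.zeroState) :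
    D.edgeMap (D.oneState c) t d (D.edgeMap D.zeroState (D.oneState c) c f) =
      D.edgeMap (D.oneState d) t c (D.edgeMap D.zeroState (D.oneState d) d f) := by
  classical
  have hle := hD.oneState_le_of_parallel hpar
  have hle' := hD.oneState_le_of_parallel hpar.symm
  have hinv : ∀ {s s' : D.State}, D.circleSetoid s ≤ D.circleSetoid s' →
      D.circleSetoid s' ≤ D.circleSetoid s → ∀ a, D.transfer s' s (D.transfer s s' a) = a := by
    intro s s' h h' a
    induction a using circle_induction with
    | h1 a => rw [transfer_circleOf h, transfer_circleOf h']
    | h2 i => rfl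
  let e : D.Circle (D.oneState c) ≃ D.Circle (D.oneState d) :=
    ⟨D.transfer _ _, D.transfer _ _, hinv hle hle', hinv hle' hle⟩
  have he : ∀ h, e (D.circleOf _ h) = D.circleOf _ h := transfer_circleOf hle
  have hp : D.edgeMap D.zeroState (D.oneState d) d f =
      pushMap e (D.edgeMap D.zeroState (D.oneState c) c f) := by
    rw [hD.edgeMap_zeroState, hD.edgeMap_zeroState, pushMap_pushMap]
    congr 2
    exact (transfer_comp (hD.zeroState_le_oneState c) hle).symm
  rw [hp]
  funext z
  rw [edgeMap_apply, edgeMap_apply]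
  rw [← Equiv.sum_comp (e.arrowCongr (Equiv.refl Bool))]
  apply Finset.sum_congr rfl
  intro x _
  have hx : (e.arrowCongr (Equiv.refl Bool) x) ∘ e = x := by
    funext a
    simp
  have hxh : ∀ h, (e.arrowCongr (Equiv.refl Bool) x) (D.circleOf _ h) = x (D.circleOf _ h) := by
    intro h
    rw [← he]
    exact congrFun hx _
  rw [pushMap_equiv_apply, hx]
  congr 1
  have k1 := (hD.circleOf_oneState_eq_iff c d).2 hpar
  have k2 := (hD.circleOf_oneState_eq_iff d c).2 hpar.symm
  obtain ⟨k3, k4⟩ := hD.circleOf_eq_of_parallel hcd hpar ht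
  have k5 := hD.circleOf_oneState_of_parallel hpar
  have hcom : ∀ α β γ, comulCoeff α β γ = comulCoeff α γ β := by decide
  have hagree : D.AgreeAway (D.oneState c) t d x z ↔
      D.AgreeAway (D.oneState d) t c (e.arrowCongr (Equiv.refl Bool) x) z := by
    apply and_congr
    · exact Iff.rfl
    · apply forall_congr'
      intro h
      rw [hxh, ← he, ← he, ← he, e.injective.ne_iff, e.injective.ne_iff, k5]
      have : D.circleOf (D.oneState c) (c, 2) = D.circleOf (D.oneState c) (d, 0) := by
        rw [← hD.circleOf_oneState, k5]
      rw [this, ← k1]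
  rw [edgeCoeff, edgeCoeff, if_neg (not_not.2 k1), if_neg (not_not.2 k2), hxh, k3, k4, k5, hcom]
  simp only [hagree]

theorem IsPositive.circleOf_eq_of_not_parallel (hD : D.IsPositive) (hcd : c ≠ d)
    (hpar : D.chord c ≠ D.chord d) (ht : t = Function.update (D.oneState c) d true) :
    D.circleOf t (d, 0) = D.circleOf t (d, 2) :=
  circleOf_eq_of_merge (agree_of_update ht) (oneState_of_ne hcd.symm)
    (by rw [ht, Function.update_self]) (mt (hD.circleOf_oneState_eq_iff c d).1 hpar)

theorem IsPositive.edgeMap_comp_of_not_parallel (hD : D.IsPositive) (hcd : c ≠ d)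
    (hpar : D.chord c ≠ D.chord d) (ht : t = Function.update (D.oneState c) d true)
    (f : D.VertexGroup D.zeroState) :
    D.edgeMap (D.oneState c) t d (D.edgeMap D.zeroState (D.oneState c) c f) =
      pushMap (D.transfer D.zeroState t) f := by
  have hk := hD.circleOf_eq_of_not_parallel hcd hpar ht
  rw [edgeMap_eq_pushMap (agree_of_update ht) (oneState_of_ne hcd.symm)
    (by rw [ht, Function.update_self]) (mt (hD.circleOf_oneState_eq_iff c d).1 hpar),
    hD.edgeMap_zeroState, pushMap_pushMap, transfer_comp (hD.zeroState_le_oneState c)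
    (circleSetoid_le_of_agree (agree_of_update ht) hk)]

/-- The squares at the bottom of the cube commute. -/
theorem IsPositive.edgeMap_comp (hD : D.IsPositive) (hcd : c ≠ d)
    (ht : t = Function.update (D.oneState c) d true) (f : D.VertexGroup D.zeroState) :
    D.edgeMap (D.oneState c) t d (D.edgeMap D.zeroState (D.oneState c) c f) =
      D.edgeMap (D.oneState d) t c (D.edgeMap D.zeroState (D.oneState d) d f) := by
  by_cases hpar : D.chord c = D.chord d
  · exact hD.edgeMap_comp_of_parallel hcd hpar ht f
  · rw [hD.edgeMap_comp_of_not_parallel hcd hpar ht,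
      hD.edgeMap_comp_of_not_parallel hcd.symm (Ne.symm hpar)
        (ht.trans (update_oneState_comm hcd))]

/-- The uniform form of the cycle condition. For parallel crossings the second map is an injective
split, leaving the kernel of one merge; otherwise two successive merges collapse both chords. -/
theorem IsPositive.edgeMap_comp_eq_zero_iff (hD : D.IsPositive) (hcd : c ≠ d)
    (ht : t = Function.update (D.oneState c) d true) (f : D.VertexGroup D.zeroState) :
    D.edgeMap (D.oneState c) t d (D.edgeMap D.zeroState (D.oneState c) c f) = 0 ↔
      f ∈ mergeKernel (D.chord c) (D.chord d) := by
  by_cases hpar : D.chord c = D.chord d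
  · rw [← hpar, ← hD.ker_edgeMap_zeroState, LinearMap.mem_ker]
    exact map_eq_zero_iff _ (hD.edgeMap_injective_of_parallel hcd hpar ht)
  · rw [hD.edgeMap_comp_of_not_parallel hcd hpar ht, ← LinearMap.mem_ker]
    have hk := hD.circleOf_eq_of_not_parallel hcd hpar ht
    have hle := circleSetoid_le_of_agree (agree_of_update ht) hk
    have hle0 := hD.zeroState_le_oneState c
    have hiff : ∀ a b, D.transfer D.zeroState t a = D.transfer D.zeroState t b ↔
        D.transfer D.zeroState (D.oneState c) a = D.transfer D.zeroState (D.oneState c) b ∨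
        ((∃ u ∈ D.chord d, D.transfer D.zeroState (D.oneState c) a =
          D.transfer D.zeroState (D.oneState c) u) ∧
        (∃ u ∈ D.chord d, D.transfer D.zeroState (D.oneState c) b =
          D.transfer D.zeroState (D.oneState c) u)) := by
      intro a b
      rw [← transfer_comp hle0 hle, Function.comp_apply, Function.comp_apply,
        transfer_eq_iff (agree_of_update ht) hk]
      simp only [chord, Sym2.mem_iff, or_and_right, exists_or, exists_eq_left,
        transfer_circleOf hle0]
    rw [ker_pushMap_eq_mergeKernel (transfer_surjective (hle0.trans hle))]
    · rintro a b (h | h)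
      · exact (hiff a b).2 (Or.inl ((hD.transfer_oneState_eq_iff c a b).2 (Or.inr h)))
      · exact (hiff a b).2 (Or.inr ⟨⟨a, h.1, rfl⟩, ⟨b, h.2, rfl⟩⟩)
    · intro W q hq a b h
      have hq1 : ∀ a b, D.transfer D.zeroState (D.oneState c) a =
          D.transfer D.zeroState (D.oneState c) b → q a = q b := by
        intro a b h
        rcases (hD.transfer_oneState_eq_iff c a b).1 h with rfl | h
        · rfl
        · exact hq a b (Or.inl h)
      rcases (hiff a b).1 h with h | ⟨⟨u, hu, hau⟩, v, hv, hbv⟩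
      · exact hq1 a b h
      · rw [hq1 a u hau, hq1 b v hbv, hq u v (Or.inr ⟨hu, hv⟩)]

end TwoCrossings

end LinkDiagram

end

/-! ### The first homology group in terms of the reduced graph -/

noncomputable section

namespace LinkDiagram

variable {D : LinkDiagram}

theorem weight_zeroState : D.weight D.zeroState = 0 := by simp [weight, zeroState]

theorem eq_zeroState_of_weight {s : D.State} (h : D.weight s = 0) : s = D.zeroState := by
  funext c
  rw [weight, Finset.card_eq_zero, Finset.filter_eq_empty_iff] at h
  simpa [zeroState] using h (Finset.mem_univ c)

theorem weight_oneState (c : Fin D.n) : D.weight (D.oneState c) = 1 := by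
  rw [weight, Finset.card_eq_one]
  refine ⟨c, ?_⟩
  ext j
  by_cases h : j = c
  · simp [h, oneState_self]
  · simp [h, oneState_of_ne h]

theorem exists_oneState_of_weight {s : D.State} (h : D.weight s = 1) : ∃ c, s = D.oneState c := by
  obtain ⟨c, hc⟩ := Finset.card_eq_one.1 h
  refine ⟨c, funext fun j => ?_⟩
  have hj : s j = true ↔ j = c := by
    simpa using Finset.ext_iff.1 hc j
  by_cases h : j = c
  · rw [hj.2 h, h, oneState_self]
  · rw [oneState_of_ne h, ← Bool.not_eq_true, hj]
    exact h

theorem oneState_injective : Function.Injective D.oneState := by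
  intro c d h
  by_contra hcd
  have := oneState_self (D := D) c
  rw [h, oneState_of_ne hcd] at this
  exact absurd this (by decide)

theorem exists_update_oneState_of_weight {t : D.State} (h : D.weight t = 2) :
    ∃ c d, c < d ∧ t = Function.update (D.oneState c) d true := by
  obtain ⟨c, d, hcd, hc⟩ := Finset.card_eq_two.1 h
  have key : t = Function.update (D.oneState c) d true := by
    funext j
    have hj : t j = true ↔ j = c ∨ j = d := by
      simpa using Finset.ext_iff.1 hc j
    rw [Bool.eq_iff_iff, hj, eq_true_iff_of_update rfl]
  rcases lt_or_gt_of_ne hcd with h | h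
  · exact ⟨c, d, h, key⟩
  · exact ⟨d, c, h, key.trans (update_oneState_comm hcd)⟩

theorem weight_update_oneState {c d : Fin D.n} (hcd : c ≠ d) :
    D.weight (Function.update (D.oneState c) d true) = 2 := by
  rw [weight, Finset.card_eq_two]
  refine ⟨c, d, hcd, ?_⟩
  ext j
  simp only [Finset.mem_filter, Finset.mem_univ, true_and, Finset.mem_insert,
    Finset.mem_singleton]
  exact eq_true_iff_of_update rfl j

open Classical in
theorem differential_apply {r q : ℤ} (x : D.ChainGroup r) (t : D.StateOfWeight q) :
    D.differential r q x t = ∑ s : D.StateOfWeight r, ∑ k : Fin D.n,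
      if s.1 k = false ∧ t.1 = Function.update s.1 k true then
        ((-1 : ℤ) ^ (Finset.univ.filter fun j => j < k ∧ s.1 j = true).card) •
          (D.edgeMap s.1 t.1 k (x s)) else 0 := by
  rw [differential, LinearMap.pi_apply, LinearMap.sum_apply]
  refine Finset.sum_congr rfl fun s _ => ?_
  rw [LinearMap.sum_apply]
  refine Finset.sum_congr rfl fun k _ => ?_
  split_ifs
  · rfl
  · rfl

theorem differential_zero_apply {q r : ℤ} (x : D.ChainGroup q) {c : Fin D.n}
    (h0 : (D.weight D.zeroState : ℤ) = q) (hc : (D.weight (D.oneState c) : ℤ) = r) :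
    D.differential q r x ⟨D.oneState c, hc⟩ =
      D.edgeMap D.zeroState (D.oneState c) c (x ⟨D.zeroState, h0⟩) := by
  classical
  rw [differential_apply, Finset.sum_eq_single ⟨D.zeroState, h0⟩]
  · rw [Finset.sum_eq_single c]
    · rw [if_pos ⟨rfl, rfl⟩]
      simp [zeroState]
    · intro k _ hk
      rw [if_neg]
      rintro ⟨-, h⟩
      exact hk (oneState_injective h).symm
    · simp
  · rintro ⟨s, hs⟩ _ hne
    refine absurd (Subtype.ext (eq_zeroState_of_weight ?_)) hne
    rw [← h0, weight_zeroState] at hs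
    exact_mod_cast hs
  · simp

theorem differential_one_apply {r q : ℤ} (x : D.ChainGroup r) {c d : Fin D.n} (hcd : c < d)
    (hc : (D.weight (D.oneState c) : ℤ) = r) (hd : (D.weight (D.oneState d) : ℤ) = r)
    {t : D.State} (ht : t = Function.update (D.oneState c) d true) (htq : (D.weight t : ℤ) = q) :
    D.differential r q x ⟨t, htq⟩ = D.edgeMap (D.oneState d) t c (x ⟨D.oneState d, hd⟩) -
      D.edgeMap (D.oneState c) t d (x ⟨D.oneState c, hc⟩) := by
  classical
  have ht' : t = Function.update (D.oneState d) c true :=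
    ht.trans (update_oneState_comm hcd.ne)
  -- A state with two markers 1 is reached from exactly two states of weight 1, by adding the
  -- missing marker.
  have hother : ∀ e k, D.oneState e k = false ∧ t = Function.update (D.oneState e) k true →
      (e = c ∧ k = d) ∨ (e = d ∧ k = c) := by
    rintro e k ⟨h1, h2⟩
    have hek : k ≠ e := by
      rintro rfl
      rw [oneState_self] at h1
      exact absurd h1 (by decide)
    have h3 : ∀ j, (j = c ∨ j = d) ↔ (j = e ∨ j = k) := fun j =>
      (eq_true_iff_of_update ht j).symm.trans (eq_true_iff_of_update h2 j)
    have h4 := (h3 e).2 (Or.inl rfl)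
    have h5 := (h3 k).2 (Or.inr rfl)
    rcases h4 with rfl | rfl <;> rcases h5 with rfl | rfl <;> simp_all
  rw [differential_apply, Finset.sum_eq_add (⟨D.oneState d, hd⟩ : D.StateOfWeight r)
    (⟨D.oneState c, hc⟩ : D.StateOfWeight r)]
  · rw [Finset.sum_eq_single c, Finset.sum_eq_single d, sub_eq_add_neg]
    · congr 1
      · rw [if_pos ⟨oneState_of_ne hcd.ne, ht'⟩]
        have : (Finset.univ.filter fun j => j < c ∧ D.oneState d j = true) = ∅ := by
          rw [Finset.filter_eq_empty_iff]
          rintro j _ ⟨h1, h2⟩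
          rw [oneState_of_ne (h1.trans hcd).ne] at h2
          exact absurd h2 (by decide)
        rw [this]
        simp
      · rw [if_pos ⟨oneState_of_ne hcd.ne', ht⟩]
        have : (Finset.univ.filter fun j => j < d ∧ D.oneState c j = true) = {c} := by
          ext j
          by_cases h : j = c
          · simp [h, hcd, oneState_self]
          · simp [h, oneState_of_ne h]
        rw [this]
        simp
    · intro k _ hk
      rw [if_neg]
      intro h
      rcases hother c k h with h | h
      · exact hk h.2
      · exact hcd.ne h.1
    · simp
    · intro k _ hk
      rw [if_neg]
      intro h
      rcases hother d k h with h | h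
      · exact hcd.ne' h.1
      · exact hk h.2
    · simp
  · intro h
    exact hcd.ne' (oneState_injective (congrArg Subtype.val h))
  · rintro ⟨s, hs⟩ _ ⟨h1, h2⟩
    rw [← hc, weight_oneState] at hs
    obtain ⟨e, rfl⟩ := exists_oneState_of_weight (by exact_mod_cast hs)
    apply Finset.sum_eq_zero
    intro k _
    rw [if_neg]
    intro h
    rcases hother e k h with ⟨rfl, _⟩ | ⟨rfl, _⟩
    · exact h2 rfl
    · exact h1 rfl
  · simp
  · simp

/-- The two paths into a state of weight 2 carry opposite signs, so the differential vanishes when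
their contributions agree. The degrees are variables because the degree in `Kh` is `1 +
numNegative`, which equals 1 only propositionally. -/
theorem mem_ker_differential_one_iff {r q : ℤ} (hq : q = 2)
    (hone : ∀ c, (D.weight (D.oneState c) : ℤ) = r) (x : D.ChainGroup r) :
    x ∈ LinearMap.ker (D.differential r q) ↔ ∀ c d, c ≠ d → ∀ t,
      t = Function.update (D.oneState c) d true →
        D.edgeMap (D.oneState c) t d (x ⟨D.oneState c, hone c⟩) =
          D.edgeMap (D.oneState d) t c (x ⟨D.oneState d, hone d⟩) := by
  rw [LinearMap.mem_ker]
  constructor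
  · intro hx c d hcd t ht
    have hw : (D.weight t : ℤ) = q := by
      rw [ht, weight_update_oneState hcd, hq]
      rfl
    have h0 := congrFun hx ⟨t, hw⟩
    rcases lt_or_gt_of_ne hcd with h | h
    · rw [differential_one_apply x h (hone c) (hone d) ht] at h0
      exact (sub_eq_zero.1 h0).symm
    · rw [differential_one_apply x h (hone d) (hone c)
        (ht.trans (update_oneState_comm hcd))] at h0
      exact sub_eq_zero.1 h0
  · intro h
    funext ⟨t, hw⟩
    have hw' : D.weight t = 2 := by
      rw [hq] at hw
      exact_mod_cast hw
    obtain ⟨c, d, hcd, ht⟩ := exists_update_oneState_of_weight hw'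
    rw [differential_one_apply x hcd (hone c) (hone d) ht, h c d hcd.ne t ht, sub_self]
    rfl

end LinkDiagram

/-- Families of elements of `V^{⊗ X}`, indexed by the edges of a graph on `X`, that agree after
merging the ends of any two edges. -/
def compatibleFamilies {X : Type*} [Fintype X] [DecidableEq X] (E : Set (Sym2 X)) :
    Submodule ℤ (E → (X → Bool) → ℤ) where
  carrier := {z | ∀ e e' : E, z e - z e' ∈ mergeKernel e.1 e'.1}
  add_mem' := fun {z w} hz hw e e' => by
    have := add_mem (hz e e') (hw e e')
    rwa [sub_add_sub_comm] at this
  zero_mem' := fun e e' => by simp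
  smul_mem' := fun a z hz e e' => by
    have := Submodule.smul_mem _ a (hz e e')
    rwa [smul_sub] at this

namespace LinkDiagram

variable {D : LinkDiagram}

/-- The first homology of the unshifted complex of a positive diagram is a quotient of the group of
compatible families on its state graph. -/
theorem IsPositive.exists_surjective (hD : D.IsPositive) {X : Type*} [Fintype X] [DecidableEq X]
    (θ : X ≃ D.Circle D.zeroState) (E : Set (Sym2 X))
    (hE : ∀ e, e ∈ E ↔ ∃ c, D.chord c = e.map θ) {r : ℤ} (hr : r = 1) :
    ∃ Φ : compatibleFamilies E →ₗ[ℤ] D.UnshiftedHomology r, Function.Surjective Φ ∧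
      ∀ z, Φ z = 0 ↔ ∃ a, ∀ e : E, z.1 e - a ∈ mergeKernel e.1 e.1 := by
  classical
  have hone : ∀ c, (D.weight (D.oneState c) : ℤ) = r := fun c => by
    rw [weight_oneState, hr]
    rfl
  have hzero : (D.weight D.zeroState : ℤ) = r - 1 := by
    rw [weight_zeroState, hr]
    rfl
  have hex : ∀ s : D.StateOfWeight r, ∃ c, s.1 = D.oneState c := fun s =>
    exists_oneState_of_weight (by exact_mod_cast s.2.trans hr)
  choose cr hcr using hex
  have hcr1 : ∀ c, cr ⟨D.oneState c, hone c⟩ = c := fun c =>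
    (oneState_injective (hcr ⟨D.oneState c, hone c⟩)).symm
  let ed : Fin D.n → E := fun c => ⟨(D.chord c).map θ.symm, (hE _).2 ⟨c, by
    rw [Sym2.map_map]
    simp⟩⟩
  have hed : ∀ c, (ed c).1.map θ = D.chord c := fun c => by
    simp only [ed]
    rw [Sym2.map_map]
    simp
  have hed_of : ∀ c (e : E), D.chord c = e.1.map θ → ed c = e := fun c e h => by
    apply Subtype.ext
    apply Sym2.map.injective θ.injective
    rw [hed, h]
  -- Each crossing receives the image, under its merge, of the family member at its chord; parallel
  -- crossings share that member.
  let Ψ : (E → (X → Bool) → ℤ) →ₗ[ℤ] D.ChainGroup r := LinearMap.pi fun s =>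
    D.edgeMap D.zeroState s.1 (cr s) ∘ₗ pushMap θ ∘ₗ LinearMap.proj (ed (cr s))
  have hΨ : ∀ z c, Ψ z ⟨D.oneState c, hone c⟩ =
      D.edgeMap D.zeroState (D.oneState c) c (pushMap θ (z (ed c))) := fun z c => by
    change D.edgeMap D.zeroState (D.oneState c) (cr ⟨D.oneState c, hone c⟩)
      (pushMap θ (z (ed (cr ⟨D.oneState c, hone c⟩)))) = _
    rw [hcr1]
  have hext : ∀ x y : D.ChainGroup r, (∀ c, x ⟨D.oneState c, hone c⟩ = y ⟨D.oneState c, hone c⟩) →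
      x = y := fun x y h => by
    funext ⟨s, hs⟩
    obtain ⟨c, rfl⟩ : ∃ c, s = D.oneState c := ⟨_, hcr ⟨s, hs⟩⟩
    exact h c
  have hker := mem_ker_differential_one_iff (D := D) (q := r + 1) (by rw [hr]; rfl) hone
  have hmaps : ∀ z : compatibleFamilies E, Ψ z.1 ∈ LinearMap.ker (D.differential r (r + 1)) := by
    intro z
    rw [hker]
    intro c d hcd t ht
    rw [hΨ, hΨ, ← hD.edgeMap_comp hcd ht, ← sub_eq_zero, ← map_sub, ← map_sub, ← map_sub,
      hD.edgeMap_comp_eq_zero_iff hcd ht, ← hed, ← hed, mem_mergeKernel_map]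
    exact z.2 _ _
  let Φ₀ : compatibleFamilies E →ₗ[ℤ] LinearMap.ker (D.differential r (r + 1)) :=
    LinearMap.codRestrict _ (Ψ ∘ₗ Submodule.subtype _) hmaps
  refine ⟨Submodule.mkQ _ ∘ₗ Φ₀, ?_, ?_⟩
  · apply (Submodule.mkQ_surjective _).comp
    rintro ⟨x, hx⟩
    rw [hker] at hx
    -- One crossing represents each class of parallel crossings; the family is obtained by lifting
    -- the cycle at these representatives only.
    choose ce hce using fun e : E => (hE e.1).1 e.2
    have hsurj : ∀ c, Function.Surjective fun f =>
        D.edgeMap D.zeroState (D.oneState c) c (pushMap θ f) := fun c =>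
      (hD.edgeMap_zeroState_surjective c).comp (pushMap_surjective θ.surjective)
    choose z hz using fun e : E => hsurj (ce e) (x ⟨D.oneState (ce e), hone (ce e)⟩)
    have hzmem : z ∈ compatibleFamilies E := by
      intro e e'
      by_cases h : ce e = ce e'
      · have : e = e' := by rw [← hed_of _ e (hce e), ← hed_of _ e' (hce e'), h]
        rw [this, sub_self]
        exact zero_mem _
      · have h1 := hx _ _ h _ rfl
        rw [← hz, ← hz, ← hD.edgeMap_comp h rfl, ← sub_eq_zero, ← map_sub, ← map_sub, ← map_sub,
          hD.edgeMap_comp_eq_zero_iff h rfl, hce, hce, mem_mergeKernel_map] at h1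
        exact h1
    refine ⟨⟨z, hzmem⟩, Subtype.ext (hext _ _ fun c => ?_)⟩
    change Ψ z _ = x _
    rw [hΨ]
    have hzc := hz (ed c)
    have hpar : D.chord c = D.chord (ce (ed c)) := by rw [hce, hed]
    by_cases h : c = ce (ed c)
    · have hcongr : ∀ c', c = c' → D.edgeMap D.zeroState (D.oneState c') c'
          (pushMap θ (z (ed c))) = x ⟨D.oneState c', hone c'⟩ →
          D.edgeMap D.zeroState (D.oneState c) c (pushMap θ (z (ed c))) =
            x ⟨D.oneState c, hone c⟩ := by
        rintro _ rfl h
        exact h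
      exact hcongr _ h hzc
    -- At a crossing parallel to the representative, the cycle condition together with injectivity
    -- of the split forces the prescribed value.
    · apply hD.edgeMap_injective_of_parallel h hpar rfl
      rw [hx _ _ h _ rfl, ← hzc]
      exact hD.edgeMap_comp h rfl _
  · intro z
    rw [LinearMap.comp_apply, Submodule.mkQ_apply, Submodule.Quotient.mk_eq_zero]
    change Ψ z.1 ∈ LinearMap.range _ ↔ _
    constructor
    · rintro ⟨y, hy⟩
      -- The chain group one degree lower is V₀ alone, so a bounding chain is a single element `a`.
      obtain ⟨a, ha⟩ := pushMap_surjective θ.surjective (y ⟨D.zeroState, hzero⟩)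
      refine ⟨a, fun e => ?_⟩
      obtain ⟨c, hc⟩ := (hE e.1).1 e.2
      have h := congrFun hy ⟨D.oneState c, hone c⟩
      rw [differential_zero_apply y hzero, hΨ, hed_of c e hc, eq_comm, ← ha, ← sub_eq_zero,
        ← map_sub, ← map_sub, ← LinearMap.mem_ker, hD.ker_edgeMap_zeroState, hc,
        mem_mergeKernel_map] at h
      exact h
    · rintro ⟨a, ha⟩
      have hall : ∀ s : D.StateOfWeight (r - 1), s.1 = D.zeroState := fun s =>
        eq_zeroState_of_weight (by
          have := s.2.trans (by rw [hr, sub_self] : r - 1 = 0)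
          exact_mod_cast this)
      refine ⟨fun s => (hall s).symm ▸ pushMap θ a, hext _ _ fun c => ?_⟩
      rw [differential_zero_apply _ hzero, hΨ, eq_comm, ← sub_eq_zero, ← map_sub, ← map_sub,
        ← LinearMap.mem_ker, hD.ker_edgeMap_zeroState, ← hed, mem_mergeKernel_map]
      exact ha _

theorem IsPositive.numNegative_eq_zero (hD : D.IsPositive) : D.numNegative = 0 := by
  rw [numNegative, Finset.card_eq_zero, Finset.filter_eq_empty_iff]
  intro c _
  rw [hD c]
  decide

theorem stateGraph_isLink_iff (c : Fin D.n) (x y : D.Circle D.zeroState) :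
    (D.stateGraph D.zeroState).IsLink c x y ↔ D.chord c = s(x, y) := eq_comm

/-- An isomorphism of `G₀(D')` with the reduced graph of `G₀(D)` matches the pairs of circles that
are joined by crossings. -/
theorem exists_chord_equiv {D' : LinkDiagram}
    (ψ : Graph.MultiIso (D'.stateGraph D'.zeroState) (D.stateGraph D.zeroState).reduced) :
    ∃ θ : D.Circle D.zeroState ≃ D'.Circle D'.zeroState, ∀ e,
      (∃ c, D.chord c = e) ↔ ∃ c', D'.chord c' = e.map θ := by
  have hv : ∀ x, x ∈ (D.stateGraph D.zeroState).reduced.vertexSet := fun x => Set.mem_univ x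
  have hv' : ∀ x, x ∈ (D'.stateGraph D'.zeroState).vertexSet := fun x => Set.mem_univ x
  let θ : D.Circle D.zeroState ≃ D'.Circle D'.zeroState :=
    ((Equiv.subtypeUnivEquiv hv).symm.trans ψ.vertexEquiv.symm).trans (Equiv.subtypeUnivEquiv hv')
  refine ⟨θ, fun e => ?_⟩
  have hθ : ∀ x, ψ.vertexEquiv ⟨θ x, hv' _⟩ = ⟨x, hv x⟩ := fun x => by
    simp only [θ]
    change ψ.vertexEquiv (ψ.vertexEquiv.symm _) = _
    rw [Equiv.apply_symm_apply]
    rfl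
  induction e using Sym2.ind with
  | _ x y =>
  rw [Sym2.map_mk]
  constructor
  · rintro ⟨c, hc⟩
    have hl : (D.stateGraph D.zeroState).reduced.IsLink s(x, y) x y :=
      ⟨rfl, c, (stateGraph_isLink_iff c x y).2 hc⟩
    obtain ⟨e, he⟩ := ψ.edgeEquiv.surjective ⟨s(x, y), hl.edge_mem⟩
    have := (ψ.isLink_iff e ⟨θ x, hv' _⟩ ⟨θ y, hv' _⟩).2 (by rw [he, hθ, hθ]; exact hl)
    exact ⟨e.1, (stateGraph_isLink_iff _ _ _).1 this⟩
  · rintro ⟨c, hc⟩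
    have hl := (stateGraph_isLink_iff c _ _).2 hc
    have := (ψ.isLink_iff ⟨c, hl.edge_mem⟩ ⟨θ x, hv' _⟩ ⟨θ y, hv' _⟩).1 hl
    rw [hθ, hθ] at this
    obtain ⟨-, d, hd⟩ := this
    exact ⟨d, (stateGraph_isLink_iff _ _ _).1 hd⟩

end LinkDiagram

end

/-! ### Comparison of the two diagrams -/

theorem theorem4p1 (D D' : LinkDiagram)
    (hred : D.IsReduced) (hpos : D.IsPositive) (hpos' : D'.IsPositive)
    (hgraph : Nonempty (Graph.MultiIso (D'.stateGraph D'.zeroState)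
      (D.stateGraph D.zeroState).reduced)) :
    Nonempty (D.Kh 1 ≃+ D'.Kh 1) := by
  obtain ⟨ψ⟩ := hgraph
  obtain ⟨θ, hθ⟩ := LinkDiagram.exists_chord_equiv ψ
  have h1 : (1 : ℤ) + D.numNegative = 1 := by rw [hpos.numNegative_eq_zero]; rfl
  have h1' : (1 : ℤ) + D'.numNegative = 1 := by rw [hpos'.numNegative_eq_zero]; rfl
  -- Both homology groups are presented as quotients of one group, the compatible families on the
  -- adjacent pairs of circles of `D`; `θ` carries these pairs to those of `D'`. The kernels are
  -- described by the same condition, hence equal.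
  obtain ⟨Φ, hs, hk⟩ := hpos.exists_surjective (Equiv.refl _) {e | ∃ c, D.chord c = e}
    (fun e => by rw [Equiv.coe_refl, Sym2.map_id]; exact Iff.rfl) h1
  obtain ⟨Φ', hs', hk'⟩ := hpos'.exists_surjective θ {e | ∃ c, D.chord c = e} hθ h1'
  have hker : LinearMap.ker Φ = LinearMap.ker Φ' := by
    ext z
    rw [LinearMap.mem_ker, LinearMap.mem_ker, hk, hk']
  exact ⟨((Φ.quotKerEquivOfSurjective hs).symm.trans
    ((Submodule.quotEquivOfEq _ _ hker).trans (Φ'.quotKerEquivOfSurjective hs'))).toAddEquiv⟩
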